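/- Work in classical first-order logic with equality in the language of set theory, whose only nonlogical symbol is $\in$. The $\Delta_0^{\mathcal P}$-formulae are the smallest class of formulae containing the atomic formulae and closed under $\wedge,\vee,\to,\neg$ and the quantifiers $\forall x\in a$, $\exists x\in a$, $\forall x\subseteq a$, $\exists x\subseteq a$; a $\Sigma_1^{\mathcal P}$-formula is one of the form $\exists x\,\psi$ with $\psi$ a $\Delta_0^{\mathcal P}$-formula. Let $\mathrm{KP}^{\mathcal P}$ be the theory whose axioms are Extensionality, Pairing, Union, Infinity, Powerset, and (universally closed, parameters being allowed) the schemata of $\Delta_0^{\mathcal P}$-Separation $\exists x\,\forall u\,[u\in x\leftrightarrow(u\in a\wedge\varphi(u))]$ and $\Delta_0^{\mathcal P}$-Collection $\forall x\in a\,\exists y\,\varphi(x,y)\to\exists z\,\forall x\in a\,\exists y\in z\,\varphi(x,y)$, for $\Delta_0^{\mathcal P}$-formulae $\varphi$, and of Set Induction $\forall x\,[(\forall y\in x\,\vartheta(y))\to\vartheta(x)]\to\forall x\,\vartheta(x)$, for $\Sigma_1^{\mathcal P}$-formulae $\vartheta$ only. Let $\mathrm{AC}$ be the axiom that for every set $a$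 there is a function $f$ with domain $a$ such that $f(x)\in x$ for every nonempty $x\in a$. Then $\mathrm{KP}^{\mathcal P}+\mathrm{AC}\vdash\Delta_0^{\mathcal P}\text{-}\mathrm{DC}$; that is, for every $\Delta_0^{\mathcal P}$-formula $R(x,y)$, possibly with further free variables as parameters, $\mathrm{KP}^{\mathcal P}+\mathrm{AC}$ proves the universal closure of the following: if $\forall x\,\exists y\,R(x,y)$, then for every set $z$ there is a function $f$ with domain $\omega$ such that $f(0)=z$ and $R(f(n),f(n+1))$ for all $n\in\omega$. -/

import Mathlib

open scoped FirstOrder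

/-! ## Provability in classical first-order logic -/

namespace FirstOrder.Language

universe u v

variable {L : FirstOrder.Language.{u, v}}

/-- `φ(t)`: substitute `t` for the variable `&0`, the one that `φ.all` binds. -/
def BoundedFormula.inst (φ : L.BoundedFormula ℕ 1) (t : L.Term ℕ) : L.Formula ℕ :=
  φ.toFormula.subst (Sum.elim Term.var (fun _ => t))

/-- `Derivable Γ φ`: natural deduction for classical first-order logic with equality. The primitive
logical symbols are `⊥`, `=`, `→` and `∀`, the others being the usual classical abbreviations.
The free variables are numbered by `ℕ`. -/
inductive Derivable : Set (L.Formula ℕ) → L.Formula ℕ → Prop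
  | ax {Γ : Set (L.Formula ℕ)} {φ : L.Formula ℕ} (h : φ ∈ Γ) : Derivable Γ φ
  | weaken {Γ Δ : Set (L.Formula ℕ)} {φ : L.Formula ℕ} (hs : Γ ⊆ Δ) (h : Derivable Γ φ) :
      Derivable Δ φ
  | impI {Γ : Set (L.Formula ℕ)} {φ ψ : L.Formula ℕ} (h : Derivable (insert φ Γ) ψ) :
      Derivable Γ (φ.imp ψ)
  | impE {Γ : Set (L.Formula ℕ)} {φ ψ : L.Formula ℕ} (h₁ : Derivable Γ (φ.imp ψ))
      (h₂ : Derivable Γ φ) : Derivable Γ ψ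
  | byContra {Γ : Set (L.Formula ℕ)} {φ : L.Formula ℕ}
      (h : Derivable (insert (φ.imp ⊥) Γ) ⊥) : Derivable Γ φ
  | allI {Γ : Set (L.Formula ℕ)} {φ : L.BoundedFormula ℕ 1} (x : ℕ)
      (hΓ : ∀ ψ ∈ Γ, x ∉ ψ.freeVarFinset) (hφ : x ∉ φ.freeVarFinset)
      (h : Derivable Γ (φ.inst (Term.var x))) : Derivable Γ φ.all
  | allE {Γ : Set (L.Formula ℕ)} {φ : L.BoundedFormula ℕ 1} (t : L.Term ℕ)
      (h : Derivable Γ φ.all) : Derivable Γ (φ.inst t)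
  | eqRefl {Γ : Set (L.Formula ℕ)} (t : L.Term ℕ) : Derivable Γ (t.equal t)
  | eqSubst {Γ : Set (L.Formula ℕ)} (φ : L.BoundedFormula ℕ 1) {s t : L.Term ℕ}
      (h₁ : Derivable Γ (s.equal t)) (h₂ : Derivable Γ (φ.inst s)) : Derivable Γ (φ.inst t)

/-- A sentence, viewed as a formula in which none of the variables in `ℕ` occurs freely. -/
def Sentence.toOpen (σ : L.Sentence) : L.Formula ℕ :=
  BoundedFormula.subst σ (fun e : Empty => e.elim)

/-- `T ⊢ σ`: there is a formal derivation of the sentence `σ` from the axioms in `T`. -/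
def Theory.Proves (T : L.Theory) (σ : L.Sentence) : Prop :=
  Derivable (Sentence.toOpen '' T) (Sentence.toOpen σ)

end FirstOrder.Language

/-! ## The language of set theory -/

namespace PowerKP

open FirstOrder FirstOrder.Language

/-- The only nonlogical symbol is the binary relation symbol of membership. -/
inductive SetRel : ℕ → Type
  | mem : SetRel 2

/-- The first-order language of set theory (the language of ZF). -/
def setLang : FirstOrder.Language.{0, 0} := ⟨fun _ => Empty, SetRel⟩

variable {α : Type} {n : ℕ}

/-- Terms (that is, variables) in a context of `n` bound variables `&0, …, &(n-1)`, with further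
free variables in `α`. A quantifier over a formula in context `n + 1` binds `&n`. -/
abbrev Tm (α : Type) (n : ℕ) := setLang.Term (α ⊕ Fin n)

/-- Formulas in such a context. -/
abbrev Fm (α : Type) (n : ℕ) := setLang.BoundedFormula α n

/-- The same term, in a context with one more bound variable. -/
def up (t : Tm α n) : Tm α (n + 1) := t.relabel (Sum.map id Fin.castSucc)

/-- The newest variable of a nonempty context, i.e. the one that a quantifier binds next. -/
def new : Tm α (n + 1) := Term.var (Sum.inr (Fin.last n))

/-- `s ∈ t` -/
def mem (s t : Tm α n) : Fm α n := Relations.boundedFormula₂ (L := setLang) SetRel.mem s t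

/-- `∀ x ∈ a, φ` -/
def allMem (a : Tm α n) (φ : Fm α (n + 1)) : Fm α n := ∀' ((mem new (up a)) ⟹ φ)

/-- `∃ x ∈ a, φ` -/
def exMem (a : Tm α n) (φ : Fm α (n + 1)) : Fm α n := ∃' ((mem new (up a)) ⊓ φ)

/-- `s ⊆ t` -/
def sub (s t : Tm α n) : Fm α n := ∀' ((mem new (up s)) ⟹ (mem new (up t)))

/-- `∀ x ⊆ a, φ` -/
def allSub (a : Tm α n) (φ : Fm α (n + 1)) : Fm α n := ∀' ((sub new (up a)) ⟹ φ)

/-- `∃ x ⊆ a, φ` -/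
def exSub (a : Tm α n) (φ : Fm α (n + 1)) : Fm α n := ∃' ((sub new (up a)) ⊓ φ)

/-- The `Δ₀^𝒫` formulas: the smallest class that contains the atomic formulas and is closed under
the propositional connectives and the quantifiers `∀ x ∈ a`, `∃ x ∈ a`, `∀ x ⊆ a`, `∃ x ⊆ a`. -/
inductive IsDelta0P : {n : ℕ} → Fm α n → Prop
  | falsum {n : ℕ} : IsDelta0P (⊥ : Fm α n)
  | eq {n : ℕ} (s t : Tm α n) : IsDelta0P (s.bdEqual t)
  | mem {n : ℕ} (s t : Tm α n) : IsDelta0P (mem s t)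
  | not {n : ℕ} {φ : Fm α n} : IsDelta0P φ → IsDelta0P (∼φ)
  | and {n : ℕ} {φ ψ : Fm α n} : IsDelta0P φ → IsDelta0P ψ → IsDelta0P (φ ⊓ ψ)
  | or {n : ℕ} {φ ψ : Fm α n} : IsDelta0P φ → IsDelta0P ψ → IsDelta0P (φ ⊔ ψ)
  | imp {n : ℕ} {φ ψ : Fm α n} : IsDelta0P φ → IsDelta0P ψ → IsDelta0P (φ ⟹ ψ)
  | allMem {n : ℕ} (a : Tm α n) {φ : Fm α (n + 1)} : IsDelta0P φ → IsDelta0P (allMem a φ)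
  | exMem {n : ℕ} (a : Tm α n) {φ : Fm α (n + 1)} : IsDelta0P φ → IsDelta0P (exMem a φ)
  | allSub {n : ℕ} (a : Tm α n) {φ : Fm α (n + 1)} : IsDelta0P φ → IsDelta0P (allSub a φ)
  | exSub {n : ℕ} (a : Tm α n) {φ : Fm α (n + 1)} : IsDelta0P φ → IsDelta0P (exSub a φ)

/-- The `Σ₁^𝒫` formulas: `∃ x, ψ` with `ψ` a `Δ₀^𝒫` formula. -/
def IsSigma1P (φ : Fm α n) : Prop := ∃ ψ : Fm α (n + 1), IsDelta0P ψ ∧ φ = ∃' ψ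

/-! ## Set-theoretic notions as formulas -/

/-- `z = {x, y}` -/
def isPair (z x y : Tm α n) : Fm α n :=
  ∀' ((mem new (up z)) ⇔ ((new =' (up x)) ⊔ (new =' (up y))))

/-- `p = ⟨x, y⟩ = {{x, x}, {x, y}}` -/
def isOrdPair (p x y : Tm α n) : Fm α n :=
  ∀' ((mem new (up p)) ⇔ ((isPair new (up x) (up x)) ⊔ (isPair new (up x) (up y))))

/-- `⟨x, y⟩ ∈ f` -/
def pairMem (f x y : Tm α n) : Fm α n :=
  ∃' ((mem new (up f)) ⊓ (isOrdPair new (up x) (up y)))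

/-- Every element of `f` is an ordered pair, and `⟨x, y⟩, ⟨x, y'⟩ ∈ f` implies `y = y'`. -/
def isFunction (f : Tm α n) : Fm α n :=
  (∀' ((mem new (up f)) ⟹ ∃' ∃' (isOrdPair (up (up new)) (up new) new))) ⊓
  (∀' ∀' ∀' ((pairMem (up (up (up f))) (up (up new)) (up new)) ⟹
    ((pairMem (up (up (up f))) (up (up new)) new) ⟹ ((up new) =' new))))

/-- `f` is a function with domain `d` -/
def isFunctionOn (f d : Tm α n) : Fm α n :=
  (isFunction f) ⊓ (∀' ((mem new (up d)) ⇔ ∃' (pairMem (up (up f)) (up new) new)))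

/-- `e = ∅` -/
def isEmptySet (e : Tm α n) : Fm α n := ∀' ∼(mem new (up e))

/-- `s = x ∪ {x}` -/
def isSucc (s x : Tm α n) : Fm α n :=
  ∀' ((mem new (up s)) ⇔ ((mem new (up x)) ⊔ (new =' (up x))))

/-- `∅ ∈ w`, and `x ∪ {x} ∈ w` whenever `x ∈ w` -/
def isInductive (w : Tm α n) : Fm α n :=
  (∃' ((isEmptySet new) ⊓ (mem new (up w)))) ⊓
  (∀' ((mem new (up w)) ⟹ ∃' ((isSucc new (up new)) ⊓ (mem new (up (up w))))))

/-- `w = ω`, the least inductive set -/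
def isOmega (w : Tm α n) : Fm α n :=
  (isInductive w) ⊓ (∀' ((isInductive new) ⟹ (sub (up w) new)))

/-! ## Axioms and schemata -/

/-- A formula with `k` distinguished free variables (the arguments) and `n` parameters. -/
abbrev Predicate (n k : ℕ) := setLang.Formula (Fin n ⊕ Fin k)

/-- `φ(v₀, …, v_{k-1})`, where the `i`-th argument is the bound variable `&(v i)`. -/
def Predicate.app {n k m : ℕ} (φ : Predicate n k) (v : Fin k → Fin m) : Fm (Fin n) m :=
  BoundedFormula.relabel (Sum.map id v) φ

/-- Universal closure over the parameters. -/
def univClosure {n : ℕ} (φ : setLang.Formula (Fin n)) : setLang.Sentence :=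
  BoundedFormula.alls (n := n)
    (BoundedFormula.relabel (Sum.inr : Fin n → Empty ⊕ Fin n) φ)

/-- `∀ a b, (∀ x, x ∈ a ↔ x ∈ b) → a = b` -/
def extensionality : setLang.Sentence :=
  ∀' ∀' ((∀' ((mem (&2) (&0)) ⇔ (mem (&2) (&1)))) ⟹ ((&0) =' (&1)))

/-- `∀ a b, ∃ c, c = {a, b}` -/
def pairing : setLang.Sentence :=
  ∀' ∀' ∃' (isPair (&2) (&0) (&1))

/-- `∀ a, ∃ u, ∀ x, x ∈ u ↔ ∃ y ∈ a, x ∈ y` -/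
def union : setLang.Sentence :=
  ∀' ∃' ∀' ((mem (&2) (&1)) ⇔ ∃' ((mem (&3) (&0)) ⊓ (mem (&2) (&3))))

/-- There is an inductive set. -/
def infinity : setLang.Sentence :=
  ∃' (isInductive (&0))

/-- `∀ a, ∃ p, ∀ x, x ∈ p ↔ x ⊆ a` -/
def powerset : setLang.Sentence :=
  ∀' ∃' ∀' ((mem (&2) (&1)) ⇔ (sub (&2) (&0)))

/-- `∀ a, ∃ x, ∀ u, u ∈ x ↔ (u ∈ a ∧ φ(u))` -/
def separation {n : ℕ} (φ : Predicate n 1) : setLang.Sentence :=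
  univClosure (∀' ∃' ∀' ((mem (&2) (&1)) ⇔ ((mem (&2) (&0)) ⊓ (φ.app ![2]))))

/-- `∀ a, (∀ x ∈ a, ∃ y, φ(x, y)) → ∃ z, ∀ x ∈ a, ∃ y ∈ z, φ(x, y)` -/
def collection {n : ℕ} (φ : Predicate n 2) : setLang.Sentence :=
  univClosure (∀' ((∀' ((mem (&1) (&0)) ⟹ ∃' (φ.app ![1, 2]))) ⟹
    ∃' ∀' ((mem (&2) (&0)) ⟹ ∃' ((mem (&3) (&1)) ⊓ (φ.app ![2, 3])))))

/-- `(∀ x, (∀ y ∈ x, φ(y)) → φ(x)) → ∀ x, φ(x)` -/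
def setInduction {n : ℕ} (φ : Predicate n 1) : setLang.Sentence :=
  univClosure ((∀' ((∀' ((mem (&1) (&0)) ⟹ (φ.app ![1]))) ⟹ (φ.app ![0]))) ⟹ ∀' (φ.app ![0]))

/-- The theory `KP^𝒫`, with set induction for `Σ₁^𝒫` formulas only. -/
def kpPower : setLang.Theory :=
  {extensionality, pairing, union, infinity, powerset} ∪
  {σ | ∃ (n : ℕ) (φ : Predicate n 1), IsDelta0P φ ∧ σ = separation φ} ∪
  {σ | ∃ (n : ℕ) (φ : Predicate n 2), IsDelta0P φ ∧ σ = collection φ} ∪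
  {σ | ∃ (n : ℕ) (φ : Predicate n 1), IsSigma1P φ ∧ σ = setInduction φ}

/-- The axiom of choice: for every set `a` there is a function `f` with domain `a` such that
`f(x) ∈ x` for every nonempty `x ∈ a`. -/
def axiomOfChoice : setLang.Sentence :=
  ∀' ∃' ((isFunctionOn (&1) (&0)) ⊓
    (∀' ((mem (&2) (&0)) ⟹ ((∃' (mem (&3) (&2))) ⟹
      ∃' ((mem (&3) (&2)) ⊓ (pairMem (&1) (&2) (&3)))))))

/-- Dependent choice for `R`: if `∀ x, ∃ y, R(x, y)`, then for every `z` there is a function `f`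
with domain `ω` such that `f(0) = z` and `R(f(n), f(n + 1))` for all `n ∈ ω`. The bound variables
are `z = &0`, `w = ω = &1`, `f = &2`; then `0 = &3` in the third conjunct, and `n = &3`,
`n + 1 = &4`, `f(n) = &5`, `f(n + 1) = &6` in the last one. -/
def dependentChoice {n : ℕ} (R : Predicate n 2) : setLang.Sentence :=
  univClosure ((∀' ∃' (R.app ![0, 1])) ⟹
    ∀' ∃' ∃' ((isOmega (&1)) ⊓ ((isFunctionOn (&2) (&1)) ⊓
      ((∃' ((isEmptySet (&3)) ⊓ (pairMem (&2) (&3) (&0)))) ⊓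
      (∀' ((mem (&3) (&1)) ⟹ ∃' ((isSucc (&4) (&3)) ⊓
        ∃' ∃' ((pairMem (&2) (&3) (&5)) ⊓
          ((pairMem (&2) (&4) (&6)) ⊓ (R.app ![5, 6]))))))))))

end PowerKP

/-! ## Completeness of the calculus for theories in the language of set theory -/

namespace FirstOrder.Language

universe u v

variable {L : FirstOrder.Language.{u, v}}

namespace Derivable

variable {Γ Δ : Set (L.Formula ℕ)} {φ ψ : L.Formula ℕ}

/-! A Henkin completeness argument for the calculus (`proves_of_models`) reduces the claim to an
arbitrary model of the theory, in which one argues with `Δ₀^𝒫` relations with parameters.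

Recursion on `ω` along a total functional `Δ₀^𝒫` relation `G` is available
(`IsOmega.exists_recursion`): the existence of an approximation reaching `n` is a `Σ₁^𝒫` statement,
hence provable by induction, and Collection gathers the approximations into one function. The given
`R` is total but not functional, so it cannot be iterated directly, and choice applies only once a
set closed under `R`-successors is at hand.

The cumulative hierarchy supplies such a set. Being a level `V_α` is `Δ₀^𝒫`, since a history
witnessing it is a subset of the level. Levels are linearly ordered by membership
(`IsLevel.comparable`), and `Σ₁^𝒫` set induction shows that every set is included in one
(`exists_isLevel_sub`). Sending `X` to the least level containing an `R`-successor of each element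
of `X` is therefore a total functional `Δ₀^𝒫` relation. Iterating it from `{z}` and taking the union
of the values gives a set `A` that contains `z` and is closed under `R`-successors
(`exists_closed`).

Now AC is applied to the power set of `A`. The resulting choice function picks, for `x ∈ A`, an
element of `{u ∈ A : R(x, u)}`. This is again a functional `Δ₀^𝒫` relation, and a second recursion
on `ω` starting at `z` gives the required sequence. -/

theorem of_bot (h : Derivable Γ ⊥) : Derivable Γ φ :=
  byContra (weaken (Set.subset_insert _ _) h)

/-- A derivation uses finitely many assumptions. -/
theorem exists_finset (h : Derivable Γ φ) :
    ∃ F : Finset (L.Formula ℕ), ↑F ⊆ Γ ∧ Derivable (F : Set (L.Formula ℕ)) φ := by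
  classical
  -- For the rules that discharge an assumption: the discharged formula is erased from the finite
  -- set.
  have key : ∀ {Γ : Set (L.Formula ℕ)} {φ ψ : L.Formula ℕ} (F : Finset (L.Formula ℕ)),
      ↑F ⊆ insert φ Γ → Derivable (F : Set (L.Formula ℕ)) ψ →
      ↑(F.erase φ) ⊆ Γ ∧ Derivable (insert φ (F.erase φ : Finset (L.Formula ℕ)) : Set _) ψ := by
    intro Γ φ ψ F hF h
    refine ⟨fun x hx => ?_, weaken (fun x hx => ?_) h⟩
    · simp only [Finset.coe_erase, Set.mem_sdiff, Set.mem_singleton_iff] at hx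
      exact (hF hx.1).resolve_left hx.2
    · by_cases hxφ : x = φ
      · exact Or.inl hxφ
      · exact Or.inr (by simpa [hxφ] using hx)
  induction h with
  | @ax Γ φ h => exact ⟨{φ}, by simpa using h, ax (by simp)⟩
  | weaken hs _ ih =>
    obtain ⟨F, hF, h⟩ := ih
    exact ⟨F, hF.trans hs, h⟩
  | impI _ ih =>
    obtain ⟨F, hF, h⟩ := ih
    exact ⟨_, (key F hF h).1, impI (key F hF h).2⟩
  | impE _ _ ih₁ ih₂ =>
    obtain ⟨F, hF, h⟩ := ih₁
    obtain ⟨G, hG, h'⟩ := ih₂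
    exact ⟨F ∪ G, by simp [hF, hG], impE (weaken (by simp) h) (weaken (by simp) h')⟩
  | byContra _ ih =>
    obtain ⟨F, hF, h⟩ := ih
    exact ⟨_, (key F hF h).1, byContra (key F hF h).2⟩
  | allI x hΓ hφ _ ih =>
    obtain ⟨F, hF, h⟩ := ih
    exact ⟨F, hF, allI x (fun ψ hψ => hΓ ψ (hF hψ)) hφ h⟩
  | allE t _ ih =>
    obtain ⟨F, hF, h⟩ := ih
    exact ⟨F, hF, allE t h⟩
  | eqRefl t => exact ⟨∅, by simp, eqRefl t⟩
  | eqSubst φ _ _ ih₁ ih₂ =>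
    obtain ⟨F, hF, h⟩ := ih₁
    obtain ⟨G, hG, h'⟩ := ih₂
    exact ⟨F ∪ G, by simp [hF, hG], eqSubst φ (weaken (by simp) h) (weaken (by simp) h')⟩

/-- The finitely many assumptions used already lie in one stage of the chain. This keeps the limit
of the Henkin construction consistent. -/
theorem exists_of_iUnion {Γ : ℕ → Set (L.Formula ℕ)} (hΓ : Monotone Γ)
    (h : Derivable (⋃ i, Γ i) φ) : ∃ i, Derivable (Γ i) φ := by
  obtain ⟨F, hF, h⟩ := h.exists_finset
  obtain ⟨i, hi⟩ := hΓ.directed_le.exists_mem_subset_of_finset_subset_biUnion hF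
  exact ⟨i, weaken hi h⟩

end Derivable

/-- The variables that occur freely in some formula of `Γ`. -/
def freeVars (Γ : Set (L.Formula ℕ)) : Set ℕ := {x | ∃ ψ ∈ Γ, x ∈ ψ.freeVarFinset}

theorem finite_freeVars_insert {Γ : Set (L.Formula ℕ)} (h : (freeVars Γ).Finite)
    (φ : L.Formula ℕ) : (freeVars (insert φ Γ)).Finite := by
  refine (h.union φ.freeVarFinset.finite_toSet).subset ?_
  rintro x ⟨ψ, rfl | hψ, hx⟩
  · exact Or.inr hx
  · exact Or.inl ⟨ψ, hψ, hx⟩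

/-- `Γ` is consistent and leaves infinitely many variables unused. -/
def Extendable (Γ : Set (L.Formula ℕ)) : Prop := ¬ Derivable Γ ⊥ ∧ (freeVars Γ).Finite

/-- A variable not free in `Γ` serves as eigenvariable: if adding `¬φ(x)` gave a contradiction, then
`φ(x)`, and hence `∀ φ`, would be derivable from `Γ`, which contains `¬∀ φ`. -/
theorem Extendable.witness {Γ : Set (L.Formula ℕ)} (hΓ : Extendable Γ) {φ : L.BoundedFormula ℕ 1}
    (hφ : φ.all.imp ⊥ ∈ Γ) :
    ∃ x : ℕ, Extendable (insert ((φ.inst (Term.var x)).imp ⊥) Γ) := by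
  obtain ⟨x, hx⟩ := hΓ.2.exists_notMem
  refine ⟨x, fun h => hΓ.1 ?_, finite_freeVars_insert hΓ.2 _⟩
  refine .impE (.ax hφ) (.allI x (fun ψ hψ hxψ => hx ⟨ψ, hψ, hxψ⟩) (fun hxφ => hx ⟨_, hφ, ?_⟩)
    (.byContra h))
  exact Finset.mem_union_left _ hxφ

theorem Extendable.step {Γ : Set (L.Formula ℕ)} (hΓ : Extendable Γ) (θ : L.Formula ℕ) :
    ∃ Δ, Γ ⊆ Δ ∧ Extendable Δ ∧ (θ ∈ Δ ∨ Derivable (insert θ Γ) ⊥) ∧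
      ∀ φ : L.BoundedFormula ℕ 1, θ = φ.all.imp ⊥ → θ ∈ Δ →
        ∃ x : ℕ, (φ.inst (Term.var x)).imp ⊥ ∈ Δ := by
  by_cases h : Derivable (insert θ Γ) ⊥
  · by_cases hθ : θ ∈ Γ
    · exact absurd (Set.insert_eq_of_mem hθ ▸ h) hΓ.1
    · exact ⟨Γ, subset_rfl, hΓ, Or.inr h, fun _ _ h => absurd h hθ⟩
  · have hE : Extendable (insert θ Γ) := ⟨h, finite_freeVars_insert hΓ.2 θ⟩
    by_cases hθ : ∃ φ : L.BoundedFormula ℕ 1, θ = φ.all.imp ⊥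
    · obtain ⟨φ, rfl⟩ := hθ
      obtain ⟨x, hx⟩ := hE.witness (Set.mem_insert _ _)
      refine ⟨_, (Set.subset_insert _ _).trans (Set.subset_insert _ _), hx,
        Or.inl (Or.inr (Or.inl rfl)), fun ψ hψ _ => ⟨x, Or.inl ?_⟩⟩
      cases hψ
      rfl
    · exact ⟨_, Set.subset_insert _ _, hE, Or.inl (Set.mem_insert _ _),
        fun φ hφ => absurd ⟨φ, hφ⟩ hθ⟩

/-- A maximal consistent set of formulas with witnesses. -/
structure IsHenkin (Δ : Set (L.Formula ℕ)) : Prop where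
  consistent : ¬ Derivable Δ ⊥
  maximal : ∀ θ, θ ∈ Δ ∨ Derivable (insert θ Δ) ⊥
  witness : ∀ φ : L.BoundedFormula ℕ 1, φ.all.imp ⊥ ∈ Δ →
    ∃ x : ℕ, (φ.inst (Term.var x)).imp ⊥ ∈ Δ

/-- Lindenbaum's construction: the formulas are enumerated, and each is added at its turn if
consistent, together with a witness if it is a negated universal formula. -/
theorem Extendable.exists_isHenkin [Countable (L.Formula ℕ)] {Γ : Set (L.Formula ℕ)}
    (hΓ : Extendable Γ) : ∃ Δ, Γ ⊆ Δ ∧ IsHenkin Δ := by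
  obtain ⟨e, he⟩ := exists_surjective_nat (L.Formula ℕ)
  choose next hsub hext hmem hwit using
    fun (Γ : {Γ : Set (L.Formula ℕ) // Extendable Γ}) θ => Γ.2.step θ
  let seq : ℕ → {Γ : Set (L.Formula ℕ) // Extendable Γ} :=
    fun n => n.rec ⟨Γ, hΓ⟩ fun k Γ => ⟨next Γ (e k), hext Γ (e k)⟩
  have hmono : Monotone fun n => (seq n).1 := monotone_nat_of_le_succ fun n => hsub (seq n) (e n)
  have hle : ∀ n, (seq n).1 ⊆ ⋃ n, (seq n).1 := Set.subset_iUnion fun n => (seq n).1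
  refine ⟨⋃ n, (seq n).1, hle 0, fun h => ?_, fun θ => ?_, fun φ hφ => ?_⟩
  · obtain ⟨n, hn⟩ := Derivable.exists_of_iUnion hmono h
    exact (seq n).2.1 hn
  · obtain ⟨n, rfl⟩ := he θ
    exact (hmem (seq n) (e n)).imp (fun h => hle (n + 1) h)
      (fun h => .weaken (Set.insert_subset_insert (hle n)) h)
  · obtain ⟨n, hn⟩ := he (φ.all.imp ⊥)
    -- The formula may have entered the union at some other stage `m`. It is still accepted at its
    -- own turn `n`, for otherwise the stage `max m n` would be inconsistent.
    have h1 : e n ∈ next (seq n) (e n) := by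
      refine (hmem (seq n) (e n)).resolve_right fun h => ?_
      obtain ⟨m, hm⟩ := Set.mem_iUnion.1 hφ
      refine (seq (max m n)).2.1 (.weaken (Set.insert_subset ?_ (hmono (le_max_right m n))) h)
      exact hn ▸ hmono (le_max_left m n) hm
    obtain ⟨x, hx⟩ := hwit (seq n) (e n) φ hn h1
    exact ⟨x, hle (n + 1) hx⟩

namespace IsHenkin

variable {Δ : Set (L.Formula ℕ)} {φ ψ : L.Formula ℕ}

theorem mem_of_derivable (hΔ : IsHenkin Δ) (h : Derivable Δ φ) : φ ∈ Δ :=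
  (hΔ.maximal φ).resolve_right fun h' => hΔ.consistent (.impE (.impI h') h)

theorem imp_mem_iff (hΔ : IsHenkin Δ) : φ.imp ψ ∈ Δ ↔ (φ ∈ Δ → ψ ∈ Δ) := by
  refine ⟨fun h h' => hΔ.mem_of_derivable (.impE (.ax h) (.ax h')), fun h => ?_⟩
  refine hΔ.mem_of_derivable (.impI ?_)
  rcases hΔ.maximal φ with hφ | hφ
  · exact .weaken (Set.subset_insert _ _) (.ax (h hφ))
  · exact hφ.of_bot

theorem bot_notMem (hΔ : IsHenkin Δ) : (⊥ : L.Formula ℕ) ∉ Δ := fun h => hΔ.consistent (.ax h)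

theorem all_mem_iff (hΔ : IsHenkin Δ) {φ : L.BoundedFormula ℕ 1} :
    (φ.all : L.Formula ℕ) ∈ Δ ↔ ∀ x : ℕ, φ.inst (Term.var x) ∈ Δ := by
  refine ⟨fun h x => hΔ.mem_of_derivable (.allE _ (.ax h)), fun h => ?_⟩
  by_contra hall
  obtain ⟨x, hx⟩ := hΔ.witness φ (hΔ.imp_mem_iff.2 fun h => absurd h hall)
  exact hΔ.bot_notMem (hΔ.imp_mem_iff.1 hx (h x))

end IsHenkin

/-- The number of logical symbols in a formula. -/
def BoundedFormula.height {α : Type*} : {n : ℕ} → L.BoundedFormula α n → ℕ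
  | _, .falsum => 0
  | _, .equal _ _ => 0
  | _, .rel _ _ => 0
  | _, .imp φ ψ => φ.height + ψ.height + 1
  | _, .all φ => φ.height + 1

/-! ### Height and truth of formulas under substitution -/

namespace BoundedFormula

variable {α β : Type*}

theorem height_castLE {m n : ℕ} (h : m ≤ n) (φ : L.BoundedFormula α m) :
    (φ.castLE h).height = φ.height := by
  induction φ generalizing n with
  | falsum => rfl
  | equal => rfl
  | rel => rfl
  | imp _ _ ih₁ ih₂ => simp [height, ih₁, ih₂]
  | all _ ih => simp [height, ih]

theorem height_mapTermRel {L' : FirstOrder.Language} {g : ℕ → ℕ}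
    (ft : ∀ n, L.Term (α ⊕ (Fin n)) → L'.Term (β ⊕ (Fin (g n))))
    (fr : ∀ n, L.Relations n → L'.Relations n)
    (h : ∀ n, L'.BoundedFormula β (g (n + 1)) → L'.BoundedFormula β (g n + 1))
    (hh : ∀ n φ, (h n φ).height = φ.height) {n : ℕ} (φ : L.BoundedFormula α n) :
    (φ.mapTermRel ft fr h).height = φ.height := by
  induction φ with
  | falsum => rfl
  | equal => rfl
  | rel => rfl
  | imp _ _ ih₁ ih₂ => simp [height, mapTermRel, ih₁, ih₂]
  | all _ ih => simp [height, mapTermRel, ih, hh]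

theorem height_toFormula {n : ℕ} (φ : L.BoundedFormula α n) :
    φ.toFormula.height = φ.height := by
  induction φ with
  | falsum => rfl
  | equal => rfl
  | rel => rfl
  | imp _ _ ih₁ ih₂ => simp [height, ih₁, ih₂]
  | all _ ih =>
    simp only [toFormula, height, relabel]
    rw [height_mapTermRel _ _ _ fun n φ => height_castLE _ φ, ih]

theorem height_inst (φ : L.BoundedFormula ℕ 1) (t : L.Term ℕ) : (φ.inst t).height = φ.height := by
  rw [inst, subst, height_mapTermRel _ _ _ (by simp), height_toFormula]

theorem realize_inst {M : Type*} [L.Structure M] (φ : L.BoundedFormula ℕ 1) (t : L.Term ℕ)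
    (v : ℕ → M) : (φ.inst t).Realize v ↔ φ.Realize v (fun _ => t.realize v) := by
  rw [inst, Formula.Realize, realize_subst, ← Formula.Realize, realize_toFormula]
  exact Iff.rfl

end BoundedFormula

end FirstOrder.Language

namespace PowerKP

open FirstOrder FirstOrder.Language

instance : setLang.IsRelational := fun _ => inferInstanceAs (IsEmpty Empty)

instance : Countable setLang.Symbols := by
  have : Countable (Σ l, setLang.Functions l) := inferInstance
  have : Function.Injective (fun _ : (Σ l, setLang.Relations l) => ()) := by
    rintro ⟨_, ⟨⟩⟩ ⟨_, ⟨⟩⟩ _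
    rfl
  have : Countable (Σ l, setLang.Relations l) := this.countable
  exact inferInstanceAs (Countable (_ ⊕ _))

/-- The formula `x ∈ y` for free variables `x` and `y`. -/
def memVar (x y : ℕ) : setLang.Formula ℕ :=
  mem (Term.var (Sum.inl x)) (Term.var (Sum.inl y))

/-- The formula `x = y` for free variables `x` and `y`. -/
def eqVar (x y : ℕ) : setLang.Formula ℕ :=
  Term.equal (Term.var x) (Term.var y)

theorem mem_inst (a b : ℕ ⊕ Fin 1) (x : ℕ) :
    (mem (Term.var a) (Term.var b) : Fm ℕ 1).inst (Term.var x) =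
      memVar (Sum.elim id (fun _ => x) a) (Sum.elim id (fun _ => x) b) := by
  refine congrArg (BoundedFormula.rel (L := setLang) SetRel.mem) (funext (Fin.forall_fin_two.2 ⟨?_, ?_⟩))
  · rcases a with a | a <;> rfl
  · rcases b with b | b <;> rfl

theorem eq_inst (a b : ℕ ⊕ Fin 1) (x : ℕ) :
    (Term.bdEqual (Term.var a) (Term.var b) : Fm ℕ 1).inst (Term.var x) =
      eqVar (Sum.elim id (fun _ => x) a) (Sum.elim id (fun _ => x) b) := by
  rcases a with a | a <;> rcases b with b | b <;> rfl

/-! ### The model of variables and the truth lemma -/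

section TermModel

variable {Δ : Set (setLang.Formula ℕ)}

theorem eqVar_refl (hΔ : IsHenkin Δ) (x : ℕ) : eqVar x x ∈ Δ :=
  hΔ.mem_of_derivable (.eqRefl _)

theorem inst_congr (hΔ : IsHenkin Δ) (φ : Fm ℕ 1) {x y : ℕ} (h : eqVar x y ∈ Δ)
    (hx : φ.inst (Term.var x) ∈ Δ) : φ.inst (Term.var y) ∈ Δ :=
  hΔ.mem_of_derivable (.eqSubst φ (.ax h) (.ax hx))

theorem eqVar_symm (hΔ : IsHenkin Δ) {x y : ℕ} (h : eqVar x y ∈ Δ) : eqVar y x ∈ Δ := by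
  have := inst_congr hΔ (Term.bdEqual (Term.var (Sum.inr 0)) (Term.var (Sum.inl x))) h
  simp only [eq_inst] at this
  exact this (eqVar_refl hΔ x)

theorem eqVar_trans (hΔ : IsHenkin Δ) {x y z : ℕ} (h : eqVar x y ∈ Δ) (h' : eqVar y z ∈ Δ) :
    eqVar x z ∈ Δ := by
  have := inst_congr hΔ (Term.bdEqual (Term.var (Sum.inl x)) (Term.var (Sum.inr 0))) h'
  simp only [eq_inst] at this
  exact this h

theorem memVar_congr (hΔ : IsHenkin Δ) {x x' y y' : ℕ} (hx : eqVar x x' ∈ Δ)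
    (hy : eqVar y y' ∈ Δ) (h : memVar x y ∈ Δ) : memVar x' y' ∈ Δ := by
  have h1 := inst_congr hΔ (mem (Term.var (Sum.inr 0)) (Term.var (Sum.inl y))) hx
  have h2 := inst_congr hΔ (mem (Term.var (Sum.inl x')) (Term.var (Sum.inr 0))) hy
  simp only [mem_inst] at h1 h2
  exact h2 (h1 h)

/-- Provable equality of variables. -/
@[reducible]
def varSetoid (hΔ : IsHenkin Δ) : Setoid ℕ where
  r x y := eqVar x y ∈ Δ
  iseqv := ⟨eqVar_refl hΔ, eqVar_symm hΔ, eqVar_trans hΔ⟩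

/-- The model whose elements are the variables up to provable equality. -/
def VarModel (hΔ : IsHenkin Δ) : Type := Quotient (varSetoid hΔ)

/-- The element of the model named by a variable. -/
def toModel (hΔ : IsHenkin Δ) (x : ℕ) : VarModel hΔ := Quotient.mk (varSetoid hΔ) x

theorem toModel_eq_iff (hΔ : IsHenkin Δ) {x y : ℕ} :
    toModel hΔ x = toModel hΔ y ↔ eqVar x y ∈ Δ :=
  Quotient.eq (r := varSetoid hΔ)

theorem toModel_surjective (hΔ : IsHenkin Δ) : Function.Surjective (toModel hΔ) :=
  Quotient.exists_rep

instance (hΔ : IsHenkin Δ) : Nonempty (VarModel hΔ) := ⟨toModel hΔ 0⟩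

instance (hΔ : IsHenkin Δ) : setLang.Structure (VarModel hΔ) where
  funMap f := isEmptyElim f
  RelMap r xs := match r with
    | SetRel.mem => ∃ x y, toModel hΔ x = xs 0 ∧ toModel hΔ y = xs 1 ∧ memVar x y ∈ Δ

theorem relMap_toModel (hΔ : IsHenkin Δ) {x y : ℕ} :
    Structure.RelMap (L := setLang) SetRel.mem ![toModel hΔ x, toModel hΔ y] ↔
      memVar x y ∈ Δ := by
  refine ⟨?_, fun h => ⟨x, y, rfl, rfl, h⟩⟩
  rintro ⟨x', y', hx, hy, h⟩
  exact memVar_congr hΔ ((toModel_eq_iff hΔ).1 hx) ((toModel_eq_iff hΔ).1 hy) h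

theorem exists_eq_var {α : Type*} (t : setLang.Term α) : ∃ a, t = Term.var a := by
  cases t with
  | var a => exact ⟨a, rfl⟩
  | func f => exact isEmptyElim f

theorem exists_eq_inl (t : Tm ℕ 0) : ∃ x, t = Term.var (Sum.inl x) := by
  obtain ⟨a | a, rfl⟩ := exists_eq_var t
  · exact ⟨a, rfl⟩
  · exact a.elim0

/-- Truth in the model of variables is membership in the underlying set of formulas. -/
theorem realize_toModel_iff (hΔ : IsHenkin Δ) (φ : setLang.Formula ℕ) :
    φ.Realize (toModel hΔ) ↔ φ ∈ Δ := by
  -- Structural induction would fail at `∀`, because the instances of a formula are not its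
  -- subformulas; they do have the same height as the body.
  induction hk : φ.height using Nat.strong_induction_on generalizing φ with
  | _ k ih =>
    subst hk
    cases φ with
    | falsum => exact ⟨False.elim, hΔ.bot_notMem⟩
    | equal s t =>
      obtain ⟨x, rfl⟩ := exists_eq_inl s
      obtain ⟨y, rfl⟩ := exists_eq_inl t
      exact toModel_eq_iff hΔ
    | rel r ts =>
      cases r
      obtain ⟨x, hx⟩ := exists_eq_inl (ts 0)
      obtain ⟨y, hy⟩ := exists_eq_inl (ts 1)
      have : ts = ![Term.var (Sum.inl x), Term.var (Sum.inl y)] :=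
        funext (Fin.forall_fin_two.2 ⟨hx, hy⟩)
      subst this
      refine Iff.trans ?_ (relMap_toModel hΔ)
      exact BoundedFormula.realize_rel₂ (L := setLang) (R := SetRel.mem)
    | imp φ ψ =>
      refine Iff.trans ?_ hΔ.imp_mem_iff.symm
      exact imp_congr (ih _ (by simp only [BoundedFormula.height]; omega) φ rfl)
        (ih _ (by simp only [BoundedFormula.height]; omega) ψ rfl)
    | all φ =>
      refine Iff.trans ?_ hΔ.all_mem_iff.symm
      refine (toModel_surjective hΔ).forall.trans (forall_congr' fun x => ?_)
      rw [← ih _ (by rw [φ.height_inst]; exact Nat.lt_succ_self _) _ rfl,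
        BoundedFormula.realize_inst]
      refine iff_of_eq (congrArg _ (funext fun i => ?_))
      rw [Subsingleton.elim (α := Fin 1) i (Fin.last 0), Fin.snoc_last]
      rfl

end TermModel

theorem realize_toOpen {M : Type*} [setLang.Structure M] (σ : setLang.Sentence) (v : ℕ → M) :
    (Sentence.toOpen σ).Realize v ↔ M ⊨ σ := by
  rw [Sentence.toOpen, Formula.Realize, BoundedFormula.realize_subst]
  exact iff_of_eq (congrArg₂ _ (Subsingleton.elim _ _) rfl)

/-- Ensures that the axioms use up no variables, so that the Henkin construction can start with
fresh ones. -/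
theorem freeVarFinset_subst_empty {n : ℕ} (φ : Fm Empty n) (f : Empty → setLang.Term ℕ) :
    (φ.subst f).freeVarFinset = ∅ := by
  have key : ∀ {n : ℕ} (t : Tm Empty n),
      (t.subst (Sum.elim (Term.relabel Sum.inl ∘ f) (Term.var ∘ Sum.inr)) :
        Tm ℕ n).varFinsetLeft = ∅ := by
    intro n t
    obtain ⟨a | a, rfl⟩ := exists_eq_var t
    · exact a.elim
    · rfl
  induction φ with
  | falsum => rfl
  | equal s t => exact (congrArg₂ _ (key s) (key t)).trans (Finset.union_empty _)
  | rel r ts =>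
    refine Finset.eq_empty_of_forall_notMem fun x hx => ?_
    obtain ⟨i, -, hi⟩ := Finset.mem_biUnion.1 hx
    exact Finset.notMem_empty x (key (ts i) ▸ hi)
  | imp _ _ ih₁ ih₂ => exact (congrArg₂ _ ih₁ ih₂).trans (Finset.union_empty _)
  | all _ ih => exact ih

/-- A sentence true in all models of `T` is derivable from `T`. -/
theorem proves_of_models (T : setLang.Theory) (σ : setLang.Sentence)
    (h : ∀ (M : Type) [setLang.Structure M] [Nonempty M], (∀ τ ∈ T, M ⊨ τ) → M ⊨ σ) :
    T.Proves σ := by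
  refine .byContra ?_
  by_contra hcon
  have hE : Extendable (insert ((Sentence.toOpen σ).imp ⊥) (Sentence.toOpen '' T)) := by
    refine ⟨hcon, finite_freeVars_insert (Set.finite_empty.subset ?_) _⟩
    rintro x ⟨_, ⟨τ, -, rfl⟩, hx⟩
    rw [Sentence.toOpen, freeVarFinset_subst_empty] at hx
    exact absurd hx (Finset.notMem_empty x)
  obtain ⟨Δ, hsub, hΔ⟩ := hE.exists_isHenkin
  have hσ := hΔ.imp_mem_iff.1 (hsub (Set.mem_insert _ _))
  refine hΔ.bot_notMem (hσ ((realize_toModel_iff hΔ _).1 ((realize_toOpen σ _).2 ?_)))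
  exact h _ fun τ hτ => (realize_toOpen τ (toModel hΔ)).1
    ((realize_toModel_iff hΔ _).2 (hsub (Or.inr ⟨τ, hτ, rfl⟩)))

/-! ## Definability by `Δ₀^𝒫` formulas in a structure -/

section Realize

variable {M : Type} [setLang.Structure M]

/-- Membership in a structure for the language of set theory. -/
def E (x y : M) : Prop := Structure.RelMap (L := setLang) SetRel.mem ![x, y]

infix:50 " ε " => E

/-- `x ⊆ y` in a structure -/
def Sub (x y : M) : Prop := ∀ z, z ε x → z ε y

variable {α : Type} {n : ℕ} {v : α → M} {xs : Fin n → M}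

/-- The value of a term. -/
abbrev val (v : α → M) (xs : Fin n → M) (t : Tm α n) : M := t.realize (Sum.elim v xs)

@[simp]
theorem val_up (t : Tm α n) (x : M) : val v (Fin.snoc xs x) (up t) = val v xs t := by
  obtain ⟨a | a, rfl⟩ := exists_eq_var t
  · rfl
  · exact Fin.snoc_castSucc (α := fun _ => M) x xs a

@[simp]
theorem val_new (x : M) : val v (Fin.snoc xs x) new = x :=
  Fin.snoc_last (α := fun _ => M) x xs

@[simp]
theorem realize_mem (s t : Tm α n) : (mem s t).Realize v xs ↔ val v xs s ε val v xs t :=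
  BoundedFormula.realize_rel₂ (L := setLang) (R := SetRel.mem)

theorem realize_eq (s t : Tm α n) : (s.bdEqual t).Realize v xs ↔ val v xs s = val v xs t :=
  Iff.rfl

@[simp]
theorem realize_sub (s t : Tm α n) : (sub s t).Realize v xs ↔ Sub (val v xs s) (val v xs t) := by
  simp [sub, Sub]

@[simp]
theorem realize_allMem (a : Tm α n) (φ : Fm α (n + 1)) : (allMem a φ).Realize v xs ↔
    ∀ x, x ε val v xs a → φ.Realize v (Fin.snoc xs x) := by
  simp [allMem]

@[simp]
theorem realize_exMem (a : Tm α n) (φ : Fm α (n + 1)) : (exMem a φ).Realize v xs ↔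
    ∃ x, x ε val v xs a ∧ φ.Realize v (Fin.snoc xs x) := by
  simp [exMem]

@[simp]
theorem realize_allSub (a : Tm α n) (φ : Fm α (n + 1)) : (allSub a φ).Realize v xs ↔
    ∀ x, Sub x (val v xs a) → φ.Realize v (Fin.snoc xs x) := by
  simp [allSub]

@[simp]
theorem realize_exSub (a : Tm α n) (φ : Fm α (n + 1)) : (exSub a φ).Realize v xs ↔
    ∃ x, Sub x (val v xs a) ∧ φ.Realize v (Fin.snoc xs x) := by
  simp [exSub]

end Realize

/-- A map of variables, extended to contexts with one more bound variable. -/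
def liftVar {α β : Type} {n m : ℕ} (e : α ⊕ Fin n → β ⊕ Fin m) :
    α ⊕ Fin (n + 1) → β ⊕ Fin (m + 1) :=
  Sum.elim (fun a => Sum.map id Fin.castSucc (e (Sum.inl a)))
    (Fin.snoc (α := fun _ => β ⊕ Fin (m + 1)) (fun i => Sum.map id Fin.castSucc (e (Sum.inr i)))
      (Sum.inr (Fin.last m)))

/-- The quantifier case of renaming: pulling an assignment back along a lifted map commutes with
adding a value for the new variable. -/
theorem elim_comp_liftVar {M α β : Type} {n m : ℕ} (e : α ⊕ Fin n → β ⊕ Fin m) (v : β → M)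
    (xs : Fin m → M) (x : M) :
    Sum.elim v (Fin.snoc xs x : Fin (m + 1) → M) ∘ liftVar e ∘ Sum.inl =
      Sum.elim v xs ∘ e ∘ Sum.inl ∧
    Sum.elim v (Fin.snoc xs x : Fin (m + 1) → M) ∘ liftVar e ∘ Sum.inr =
      Fin.snoc (Sum.elim v xs ∘ e ∘ Sum.inr) x := by
  have key : ∀ b : β ⊕ Fin m, Sum.elim v (Fin.snoc xs x : Fin (m + 1) → M)
      (Sum.map id Fin.castSucc b) = Sum.elim v xs b := by
    rintro (b | b) <;> simp
  constructor
  · funext a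
    simp [liftVar, key]
  · funext i
    refine Fin.lastCases ?_ (fun i => ?_) i
    · simp [liftVar]
    · simp [liftVar, key]

/-- The class of `Δ₀^𝒫` formulas is closed, up to equivalence, under changes of variables. -/
theorem IsDelta0P.exists_relabel {α β : Type} {n : ℕ} {φ : Fm α n} (hφ : IsDelta0P φ)
    {m : ℕ} (e : α ⊕ Fin n → β ⊕ Fin m) :
    ∃ ψ : Fm β m, IsDelta0P ψ ∧ ∀ (M : Type) [setLang.Structure M] (v : β → M) (xs : Fin m → M),
      ψ.Realize v xs ↔
        φ.Realize (Sum.elim v xs ∘ e ∘ Sum.inl) (Sum.elim v xs ∘ e ∘ Sum.inr) := by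
  have term : ∀ {n m : ℕ} (e : α ⊕ Fin n → β ⊕ Fin m) (t : Tm α n), ∃ s : Tm β m,
      ∀ (M : Type) [setLang.Structure M] (v : β → M) (xs : Fin m → M),
        val v xs s = val (Sum.elim v xs ∘ e ∘ Sum.inl) (Sum.elim v xs ∘ e ∘ Sum.inr) t := by
    intro n m e t
    obtain ⟨a, rfl⟩ := exists_eq_var t
    exact ⟨.var (e a), fun M _ v xs => by rcases a with a | a <;> rfl⟩
  induction hφ generalizing m with
  | falsum => exact ⟨⊥, .falsum, fun M _ v xs => Iff.rfl⟩
  | eq s t =>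
    obtain ⟨s', hs⟩ := term e s
    obtain ⟨t', ht⟩ := term e t
    exact ⟨_, .eq s' t', fun M _ v xs => by
      rw [realize_eq, realize_eq, hs, ht]⟩
  | mem s t =>
    obtain ⟨s', hs⟩ := term e s
    obtain ⟨t', ht⟩ := term e t
    exact ⟨_, .mem s' t', fun M _ v xs => by rw [realize_mem, realize_mem, hs, ht]⟩
  | not _ ih =>
    obtain ⟨ψ, hψ, h⟩ := ih e
    exact ⟨_, hψ.not, fun M _ v xs => not_congr (h M v xs)⟩
  | and _ _ ih₁ ih₂ =>
    obtain ⟨ψ₁, hψ₁, h₁⟩ := ih₁ e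
    obtain ⟨ψ₂, hψ₂, h₂⟩ := ih₂ e
    exact ⟨_, hψ₁.and hψ₂, fun M _ v xs => by simp [h₁, h₂]⟩
  | or _ _ ih₁ ih₂ =>
    obtain ⟨ψ₁, hψ₁, h₁⟩ := ih₁ e
    obtain ⟨ψ₂, hψ₂, h₂⟩ := ih₂ e
    exact ⟨_, hψ₁.or hψ₂, fun M _ v xs => by simp [h₁, h₂]⟩
  | imp _ _ ih₁ ih₂ =>
    obtain ⟨ψ₁, hψ₁, h₁⟩ := ih₁ e
    obtain ⟨ψ₂, hψ₂, h₂⟩ := ih₂ e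
    exact ⟨_, hψ₁.imp hψ₂, fun M _ v xs => by simp [h₁, h₂]⟩
  | allMem a _ ih =>
    obtain ⟨ψ, hψ, h⟩ := ih (liftVar e)
    obtain ⟨b, hb⟩ := term e a
    exact ⟨_, hψ.allMem b, fun M _ v xs => by
      simp only [realize_allMem, h, hb, (elim_comp_liftVar e v xs _).1,
        (elim_comp_liftVar e v xs _).2]⟩
  | exMem a _ ih =>
    obtain ⟨ψ, hψ, h⟩ := ih (liftVar e)
    obtain ⟨b, hb⟩ := term e a
    exact ⟨_, hψ.exMem b, fun M _ v xs => by
      simp only [realize_exMem, h, hb, (elim_comp_liftVar e v xs _).1,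
        (elim_comp_liftVar e v xs _).2]⟩
  | allSub a _ ih =>
    obtain ⟨ψ, hψ, h⟩ := ih (liftVar e)
    obtain ⟨b, hb⟩ := term e a
    exact ⟨_, hψ.allSub b, fun M _ v xs => by
      simp only [realize_allSub, h, hb, (elim_comp_liftVar e v xs _).1,
        (elim_comp_liftVar e v xs _).2]⟩
  | exSub a _ ih =>
    obtain ⟨ψ, hψ, h⟩ := ih (liftVar e)
    obtain ⟨b, hb⟩ := term e a
    exact ⟨_, hψ.exSub b, fun M _ v xs => by
      simp only [realize_exSub, h, hb, (elim_comp_liftVar e v xs _).1,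
        (elim_comp_liftVar e v xs _).2]⟩

theorem snoc_eta {M : Type} {n : ℕ} {B : (Fin n → M) → M → Prop} (v : Fin n → M) (x : M) :
    B (fun i => (Fin.snoc v x : Fin (n + 1) → M) i.castSucc)
      ((Fin.snoc v x : Fin (n + 1) → M) (Fin.last n)) ↔ B v x := by
  simp

/-! ### Closure properties of definability, arranged for instance search -/

section Definable

variable {M : Type} [setLang.Structure M] {n : ℕ}

/-- `t` is a coordinate or a constant function. -/
class IsVar (t : (Fin n → M) → M) : Prop where
  exists_var : ∃ a : M ⊕ Fin n, ∀ v, Sum.elim id v a = t v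

/-- `P` is defined by a `Δ₀^𝒫` formula with parameters. -/
class Definable (P : (Fin n → M) → Prop) : Prop where
  exists_formula : ∃ φ : Fm M n, IsDelta0P φ ∧ ∀ v, φ.Realize id v ↔ P v

instance (c : M) : IsVar (fun _ : Fin n → M => c) := ⟨Sum.inl c, fun _ => rfl⟩

instance (i : Fin n) : IsVar (fun v : Fin n → M => v i) := ⟨Sum.inr i, fun _ => rfl⟩

/-- Carries variables of the outer context under a quantifier. -/
instance (priority := low) (t : (Fin n → M) → M) [h : IsVar t] :
    IsVar (fun w : Fin (n + 1) → M => t fun i => w i.castSucc) := by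
  obtain ⟨a | a, h⟩ := h.exists_var
  · exact ⟨Sum.inl a, fun w => h _⟩
  · exact ⟨Sum.inr a.castSucc, fun w => h fun i => w i.castSucc⟩

theorem IsVar.exists_term (t : (Fin n → M) → M) [h : IsVar t] :
    ∃ s : Tm M n, ∀ v, val id v s = t v := by
  obtain ⟨a, ha⟩ := h.exists_var
  exact ⟨.var a, ha⟩

theorem Definable.congr {P Q : (Fin n → M) → Prop} (hP : Definable P) (h : ∀ v, P v ↔ Q v) :
    Definable Q := by
  rwa [← funext fun v => propext (h v)]

variable {P Q : (Fin n → M) → Prop} {s t : (Fin n → M) → M}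
variable {A : (Fin n → M) → M → Prop}

instance : Definable (fun _ : Fin n → M => False) := ⟨⊥, .falsum, fun _ => Iff.rfl⟩

instance [IsVar s] [IsVar t] : Definable (fun v => s v = t v) := by
  obtain ⟨s', hs⟩ := IsVar.exists_term s
  obtain ⟨t', ht⟩ := IsVar.exists_term t
  exact ⟨_, .eq s' t', fun v => by rw [realize_eq, hs, ht]⟩

instance [IsVar s] [IsVar t] : Definable (fun v => s v ε t v) := by
  obtain ⟨s', hs⟩ := IsVar.exists_term s
  obtain ⟨t', ht⟩ := IsVar.exists_term t
  exact ⟨_, .mem s' t', fun v => by rw [realize_mem, hs, ht]⟩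

instance [hP : Definable P] : Definable (fun v => ¬ P v) := by
  obtain ⟨φ, hφ, h⟩ := hP
  exact ⟨_, hφ.not, fun v => not_congr (h v)⟩

instance [hP : Definable P] [hQ : Definable Q] : Definable (fun v => P v ∧ Q v) := by
  obtain ⟨φ, hφ, h⟩ := hP
  obtain ⟨ψ, hψ, h'⟩ := hQ
  exact ⟨_, hφ.and hψ, fun v => by simp [h, h']⟩

instance [hP : Definable P] [hQ : Definable Q] : Definable (fun v => P v ∨ Q v) := by
  obtain ⟨φ, hφ, h⟩ := hP
  obtain ⟨ψ, hψ, h'⟩ := hQ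
  exact ⟨_, hφ.or hψ, fun v => by simp [h, h']⟩

instance [hP : Definable P] [hQ : Definable Q] : Definable (fun v => P v → Q v) := by
  obtain ⟨φ, hφ, h⟩ := hP
  obtain ⟨ψ, hψ, h'⟩ := hQ
  exact ⟨_, hφ.imp hψ, fun v => by simp [h, h']⟩

instance [Definable P] [Definable Q] : Definable (fun v => P v ↔ Q v) :=
  .congr (P := fun v => (P v → Q v) ∧ (Q v → P v)) inferInstance fun _ => iff_def.symm

instance [IsVar t] [hA : Definable fun w : Fin (n + 1) → M =>
    A (fun i => w i.castSucc) (w (Fin.last n))] :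
    Definable (fun v => ∀ x, x ε t v → A v x) := by
  obtain ⟨φ, hφ, h⟩ := hA
  obtain ⟨t', ht⟩ := IsVar.exists_term t
  exact ⟨_, hφ.allMem t', fun v => by simp only [realize_allMem, ht, h, snoc_eta]⟩

instance [IsVar t] [hA : Definable fun w : Fin (n + 1) → M =>
    A (fun i => w i.castSucc) (w (Fin.last n))] :
    Definable (fun v => ∃ x, x ε t v ∧ A v x) := by
  obtain ⟨φ, hφ, h⟩ := hA
  obtain ⟨t', ht⟩ := IsVar.exists_term t
  exact ⟨_, hφ.exMem t', fun v => by simp only [realize_exMem, ht, h, snoc_eta]⟩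

instance [IsVar t] [hA : Definable fun w : Fin (n + 1) → M =>
    A (fun i => w i.castSucc) (w (Fin.last n))] :
    Definable (fun v => ∀ x, Sub x (t v) → A v x) := by
  obtain ⟨φ, hφ, h⟩ := hA
  obtain ⟨t', ht⟩ := IsVar.exists_term t
  exact ⟨_, hφ.allSub t', fun v => by simp only [realize_allSub, ht, h, snoc_eta]⟩

instance [IsVar t] [hA : Definable fun w : Fin (n + 1) → M =>
    A (fun i => w i.castSucc) (w (Fin.last n))] :
    Definable (fun v => ∃ x, Sub x (t v) ∧ A v x) := by
  obtain ⟨φ, hφ, h⟩ := hA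
  obtain ⟨t', ht⟩ := IsVar.exists_term t
  exact ⟨_, hφ.exSub t', fun v => by simp only [realize_exSub, ht, h, snoc_eta]⟩

instance [IsVar s] [IsVar t] : Definable (fun v => Sub (s v) (t v)) :=
  inferInstanceAs (Definable fun v => ∀ x, x ε s v → x ε t v)

/-- Definable relations remain definable when variables are substituted. -/
theorem Definable.subst {m : ℕ} (P : (Fin m → M) → Prop) [hP : Definable P]
    (t : Fin m → (Fin n → M) → M) [ht : ∀ i, IsVar (t i)] :
    Definable fun v => P fun i => t i v := by
  choose a ha using fun i => (ht i).exists_var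
  obtain ⟨φ, hφ, h⟩ := hP
  obtain ⟨ψ, hψ, h'⟩ := hφ.exists_relabel (Sum.elim Sum.inl a)
  refine ⟨ψ, hψ, fun v => (h' M id v).trans (Iff.trans ?_ (h _))⟩
  exact iff_of_eq (congrArg₂ _ rfl (funext fun i => ha i v))

theorem Definable.comp (P : M → Prop) [Definable fun v : Fin 1 → M => P (v 0)]
    (t : (Fin n → M) → M) [IsVar t] : Definable fun v => P (t v) :=
  Definable.subst (fun v : Fin 1 → M => P (v 0)) fun _ => t

theorem IsDelta0P.definable {k m : ℕ} {φ : Predicate k m} (hφ : IsDelta0P φ) (p : Fin k → M) :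
    Definable fun v => φ.Realize (Sum.elim p v) := by
  obtain ⟨ψ, hψ, h⟩ := hφ.exists_relabel (Sum.elim (Sum.map p id) Fin.elim0)
  refine ⟨ψ, hψ, fun v => (h M id v).trans (iff_of_eq (congrArg₂ _ (funext ?_) ?_))⟩
  · rintro (i | i) <;> rfl
  · exact Subsingleton.elim _ _

/-- `G` is a definable binary relation. -/
class DefinableRel (G : M → M → Prop) : Prop where
  definable : Definable fun v : Fin 2 → M => G (v 0) (v 1)

instance (priority := low) DefinableRel.comp (G : M → M → Prop) [hG : DefinableRel G] [hs : IsVar s]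
    [ht : IsVar t] : Definable fun v => G (s v) (t v) :=
  have := hG.definable
  have : ∀ i, IsVar (![s, t] i) := Fin.forall_fin_two.2 ⟨hs, ht⟩
  Definable.subst (fun v : Fin 2 → M => G (v 0) (v 1)) ![s, t]

/-- A definable relation is defined by a formula with finitely many parameters. -/
theorem Definable.exists_predicate (P : (Fin n → M) → Prop) [hP : Definable P] :
    ∃ (k : ℕ) (φ : Predicate k n) (p : Fin k → M), IsDelta0P φ ∧
      ∀ v, φ.Realize (Sum.elim p v) ↔ P v := by
  classical
  obtain ⟨φ, hφ, h⟩ := hP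
  rcases isEmpty_or_nonempty M with hM | ⟨⟨c⟩⟩
  · obtain ⟨ψ, hψ, h'⟩ := hφ.exists_relabel (β := Fin 0 ⊕ Fin n) (m := 0)
      (Sum.elim isEmptyElim fun i => Sum.inl (Sum.inr i))
    refine ⟨0, ψ, Fin.elim0, hψ, fun v => (h' M _ _).trans (Iff.trans ?_ (h v))⟩
    exact iff_of_eq (congrArg₂ _ (Subsingleton.elim _ _) rfl)
  -- The renaming must be defined on all of `M`. Elements that do not occur in `φ` are sent to the
  -- default parameter `c`, which is harmless.
  · let F := insert c φ.freeVarFinset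
    let f := F.equivFin
    obtain ⟨ψ, hψ, h'⟩ := hφ.exists_relabel (β := Fin F.card ⊕ Fin n) (m := 0)
      (Sum.elim (fun a => Sum.inl (Sum.inl (f (if ha : a ∈ F then ⟨a, ha⟩
        else ⟨c, Finset.mem_insert_self _ _⟩)))) fun i => Sum.inl (Sum.inr i))
    refine ⟨_, ψ, fun i => f.symm i, hψ, fun v => (h' M _ _).trans (Iff.trans ?_ (h v))⟩
    have hr := fun v' hv' => BoundedFormula.realize_restrictFreeVar (φ := φ)
      (f := fun a => a.1) (v := (id : M → M)) (xs := v) v' hv'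
    refine Iff.trans ?_ (hr id fun _ => rfl)
    refine Iff.symm (hr _ fun a => ?_)
    have : a.1 ∈ F := Finset.mem_insert_of_mem a.2
    simp [this]

end Definable

/-! ## Models of `KP^𝒫` -/

section Notions

variable {M : Type} [setLang.Structure M]

/-- `z = {x, y}` -/
def IsPair (z x y : M) : Prop := ∀ u, u ε z ↔ u = x ∨ u = y

/-- `p = ⟨x, y⟩` -/
def IsOrdPair (p x y : M) : Prop := ∀ u, u ε p ↔ IsPair u x x ∨ IsPair u x y

/-- `⟨x, y⟩ ∈ f` -/
def PairMem (f x y : M) : Prop := ∃ p, p ε f ∧ IsOrdPair p x y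

/-- `f` is a function. -/
def IsFunction (f : M) : Prop :=
  (∀ p, p ε f → ∃ x y, IsOrdPair p x y) ∧ ∀ x y y', PairMem f x y → PairMem f x y' → y = y'

/-- `f` is a function with domain `d`. -/
def IsFunctionOn (f d : M) : Prop := IsFunction f ∧ ∀ x, x ε d ↔ ∃ y, PairMem f x y

/-- `e = ∅` -/
def IsEmptySet (e : M) : Prop := ∀ x, ¬ x ε e

/-- `s = x ∪ {x}` -/
def IsSucc (s x : M) : Prop := ∀ u, u ε s ↔ u ε x ∨ u = x

/-- `w` contains `∅` and is closed under successors. -/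
def IsInductive (w : M) : Prop :=
  (∃ e, IsEmptySet e ∧ e ε w) ∧ ∀ x, x ε w → ∃ s, IsSucc s x ∧ s ε w

/-- `w = ω` -/
def IsOmega (w : M) : Prop := IsInductive w ∧ ∀ u, IsInductive u → Sub w u

theorem IsSucc.self_mem {s x : M} (h : IsSucc s x) : x ε s := (h x).2 (Or.inr rfl)

variable {α : Type} {n : ℕ} {v : α → M} {xs : Fin n → M}

@[simp]
theorem realize_isPair (z x y : Tm α n) : (isPair z x y).Realize v xs ↔
    IsPair (val v xs z) (val v xs x) (val v xs y) := by
  simp [isPair, IsPair]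

@[simp]
theorem realize_isOrdPair (z x y : Tm α n) : (isOrdPair z x y).Realize v xs ↔
    IsOrdPair (val v xs z) (val v xs x) (val v xs y) := by
  simp [isOrdPair, IsOrdPair]

@[simp]
theorem realize_pairMem (z x y : Tm α n) : (pairMem z x y).Realize v xs ↔
    PairMem (val v xs z) (val v xs x) (val v xs y) := by
  simp [pairMem, PairMem]

@[simp]
theorem realize_isFunction (f : Tm α n) : (isFunction f).Realize v xs ↔
    IsFunction (val v xs f) := by
  simp [isFunction, IsFunction]

@[simp]
theorem realize_isFunctionOn (f d : Tm α n) : (isFunctionOn f d).Realize v xs ↔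
    IsFunctionOn (val v xs f) (val v xs d) := by
  simp [isFunctionOn, IsFunctionOn]

@[simp]
theorem realize_isEmptySet (e : Tm α n) : (isEmptySet e).Realize v xs ↔
    IsEmptySet (val v xs e) := by
  simp [isEmptySet, IsEmptySet]

@[simp]
theorem realize_isSucc (s x : Tm α n) : (isSucc s x).Realize v xs ↔
    IsSucc (val v xs s) (val v xs x) := by
  simp [isSucc, IsSucc]

@[simp]
theorem realize_isInductive (w : Tm α n) : (isInductive w).Realize v xs ↔
    IsInductive (val v xs w) := by
  simp [isInductive, IsInductive]

@[simp]
theorem realize_isOmega (w : Tm α n) : (isOmega w).Realize v xs ↔ IsOmega (val v xs w) := by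
  simp [isOmega, IsOmega]

@[simp]
theorem realize_app {n k m : ℕ} (φ : Predicate n k) (i : Fin k → Fin m) {p : Fin n → M}
    {xs : Fin m → M} : (φ.app i).Realize p xs ↔ φ.Realize (Sum.elim p (xs ∘ i)) := by
  refine BoundedFormula.realize_relabel.trans (iff_of_eq (congrArg₂ _ ?_ ?_))
  · funext a
    rcases a with a | a <;> rfl
  · exact Subsingleton.elim _ _

@[simp]
theorem comp_vec_one {M : Type} {m : ℕ} (xs : Fin m → M) (i : Fin m) : xs ∘ ![i] = ![xs i] :=
  funext (Fin.forall_fin_one.2 rfl)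

@[simp]
theorem comp_vec_two {M : Type} {m : ℕ} (xs : Fin m → M) (i j : Fin m) :
    xs ∘ ![i, j] = ![xs i, xs j] :=
  funext (Fin.forall_fin_two.2 ⟨rfl, rfl⟩)

theorem models_univClosure {n : ℕ} (φ : setLang.Formula (Fin n)) :
    M ⊨ univClosure φ ↔ ∀ p : Fin n → M, φ.Realize p := by
  refine BoundedFormula.realize_alls.trans (forall_congr' fun p => ?_)
  refine BoundedFormula.realize_relabel.trans (iff_of_eq (congrArg₂ _ ?_ ?_))
  · rfl
  · exact Subsingleton.elim _ _

end Notions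

/-- A structure satisfying the axioms of `KP^𝒫`. -/
class KPModel (M : Type) [setLang.Structure M] : Prop where
  models : ∀ τ ∈ kpPower, M ⊨ τ

section Axioms

variable {M : Type} [setLang.Structure M] [KPModel M]

theorem ext {a b : M} (h : ∀ x, x ε a ↔ x ε b) : a = b := by
  have := KPModel.models (M := M) extensionality (by simp [kpPower])
  simp [extensionality, Sentence.Realize, Formula.Realize, Fin.snoc] at this
  exact this a b h

theorem exists_isPair (a b : M) : ∃ c, IsPair c a b := by
  have := KPModel.models (M := M) pairing (by simp [kpPower])
  simp [pairing, Sentence.Realize, Formula.Realize, Fin.snoc] at this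
  exact this a b

theorem exists_union (a : M) : ∃ u : M, ∀ x, x ε u ↔ ∃ y, y ε a ∧ x ε y := by
  have := KPModel.models (M := M) union (by simp [kpPower])
  simp [union, Sentence.Realize, Formula.Realize, Fin.snoc] at this
  exact this a

theorem exists_isInductive (M : Type) [setLang.Structure M] [KPModel M] :
    ∃ w : M, IsInductive w := by
  have := KPModel.models (M := M) infinity (by simp [kpPower])
  simpa [infinity, Sentence.Realize, Formula.Realize, Fin.snoc] using this

theorem exists_powerset (a : M) : ∃ u : M, ∀ x, x ε u ↔ Sub x a := by
  have := KPModel.models (M := M) powerset (by simp [kpPower])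
  simp [powerset, Sentence.Realize, Formula.Realize, Fin.snoc] at this
  exact this a

theorem exists_sep (P : M → Prop) [Definable fun v : Fin 1 → M => P (v 0)] (a : M) :
    ∃ b : M, ∀ x, x ε b ↔ x ε a ∧ P x := by
  obtain ⟨k, φ, p, hφ, h⟩ := Definable.exists_predicate fun v : Fin 1 → M => P (v 0)
  have := KPModel.models (M := M) (separation φ) (Or.inl (Or.inl (Or.inr ⟨k, φ, hφ, rfl⟩)))
  have := (models_univClosure _).1 this p
  rw [Formula.Realize] at this
  simp [h, Fin.snoc] at this
  exact this a

theorem collect (R : M → M → Prop) [Definable fun v : Fin 2 → M => R (v 0) (v 1)] {a : M}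
    (hR : ∀ x, x ε a → ∃ y, R x y) : ∃ z : M, ∀ x, x ε a → ∃ y, y ε z ∧ R x y := by
  obtain ⟨k, φ, p, hφ, h⟩ := Definable.exists_predicate fun v : Fin 2 → M => R (v 0) (v 1)
  have := KPModel.models (M := M) (collection φ) (Or.inl (Or.inr ⟨k, φ, hφ, rfl⟩))
  have := (models_univClosure _).1 this p
  rw [Formula.Realize] at this
  simp [h, Fin.snoc] at this
  exact this a hR

theorem sigma_induction (R : M → M → Prop) [Definable fun v : Fin 2 → M => R (v 0) (v 1)]
    (hR : ∀ x, (∀ y, y ε x → ∃ w, R y w) → ∃ w, R x w) (x : M) : ∃ w, R x w := by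
  obtain ⟨k, φ, p, hφ, h⟩ := Definable.exists_predicate fun v : Fin 2 → M => R (v 0) (v 1)
  obtain ⟨ψ, hψ, h'⟩ := hφ.exists_relabel (β := Fin k ⊕ Fin 1) (m := 1)
    (Sum.elim (Sum.elim (fun i => Sum.inl (Sum.inl i)) ![Sum.inl (Sum.inr 0), Sum.inr 0])
      Fin.elim0)
  have hex : ∀ x, Formula.Realize (∃' ψ : Predicate k 1) (Sum.elim p ![x]) ↔
      ∃ w, R x w := by
    intro x
    rw [Formula.Realize, BoundedFormula.realize_ex]
    refine exists_congr fun w => (h' M _ _).trans (Iff.trans (iff_of_eq (congrArg₂ _ (funext ?_)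
      (Subsingleton.elim _ _))) (h ![x, w]))
    rintro (i | i)
    · rfl
    · revert i
      exact Fin.forall_fin_two.2 ⟨rfl, rfl⟩
  have := KPModel.models (M := M) (setInduction (∃' ψ)) (Or.inr ⟨k, _, ⟨ψ, hψ, rfl⟩, rfl⟩)
  have := (models_univClosure _).1 this p
  rw [Formula.Realize] at this
  simp [hex, Fin.snoc] at this
  exact this hR x

theorem set_induction (P : M → Prop) [Definable fun v : Fin 1 → M => P (v 0)]
    (hP : ∀ x, (∀ y, y ε x → P y) → P x) (x : M) : P x := by
  -- A dummy existential quantifier makes `P` a `Σ₁^𝒫` property.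
  have : Definable fun v : Fin 2 → M => P (v 0) :=
    Definable.comp P _
  obtain ⟨_, h⟩ := sigma_induction (fun x _ => P x)
    (fun x h => ⟨x, hP x fun y hy => (h y hy).elim fun _ => id⟩) x
  exact h

end Axioms

/-! ## Pairs and natural numbers in models of `KP^𝒫` -/

section Pairs

variable {M : Type} [setLang.Structure M] [KPModel M]

theorem exists_insert (a b : M) : ∃ c : M, ∀ x, x ε c ↔ x ε a ∨ x = b := by
  obtain ⟨s, hs⟩ := exists_isPair b b
  obtain ⟨p, hp⟩ := exists_isPair a s
  obtain ⟨u, hu⟩ := exists_union p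
  refine ⟨u, fun x => ?_⟩
  rw [hu]
  constructor
  · rintro ⟨y, hy, hx⟩
    rcases (hp y).1 hy with rfl | rfl
    · exact Or.inl hx
    · exact Or.inr (by simpa using (hs x).1 hx)
  · rintro (hx | rfl)
    · exact ⟨a, (hp a).2 (Or.inl rfl), hx⟩
    · exact ⟨s, (hp s).2 (Or.inr rfl), (hs _).2 (Or.inl rfl)⟩

theorem IsPair.unique {z z' x y : M} (h : IsPair z x y) (h' : IsPair z' x y) : z = z' :=
  ext fun u => (h u).trans (h' u).symm

theorem exists_isOrdPair (x y : M) : ∃ p, IsOrdPair p x y := by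
  obtain ⟨s, hs⟩ := exists_isPair x x
  obtain ⟨d, hd⟩ := exists_isPair x y
  obtain ⟨p, hp⟩ := exists_isPair s d
  refine ⟨p, fun u => (hp u).trans (or_congr ⟨?_, fun h => h.unique hs⟩ ⟨?_, fun h => h.unique hd⟩)⟩
  · rintro rfl
    exact hs
  · rintro rfl
    exact hd

theorem IsOrdPair.unique {p p' x y : M} (h : IsOrdPair p x y) (h' : IsOrdPair p' x y) : p = p' :=
  ext fun u => (h u).trans (h' u).symm

theorem IsOrdPair.inj {p x y x' y' : M} (h : IsOrdPair p x y) (h' : IsOrdPair p x' y') :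
    x = x' ∧ y = y' := by
  have key : ∀ {p x y x' y' : M}, IsOrdPair p x y → IsOrdPair p x' y' →
      x = x' ∧ (y = x' ∨ y = y') := by
    intro p x y x' y' h h'
    obtain ⟨s, hs⟩ := exists_isPair x x
    obtain ⟨d, hd⟩ := exists_isPair x y
    have hx : x = x' := by
      rcases (h' s).1 ((h s).2 (Or.inl hs)) with h1 | h1
      · simpa using (Eq.symm <| by simpa using (hs x').1 ((h1 x').2 (Or.inl rfl)) : x = x')
      · simpa using (Eq.symm <| by simpa using (hs x').1 ((h1 x').2 (Or.inl rfl)) : x = x')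
    refine ⟨hx, ?_⟩
    rcases (h' d).1 ((h d).2 (Or.inr hd)) with h1 | h1
    · exact Or.inl (by simpa using (h1 y).1 ((hd y).2 (Or.inr rfl)))
    · exact (h1 y).1 ((hd y).2 (Or.inr rfl))
  obtain ⟨rfl, h1⟩ := key h h'
  obtain ⟨-, h2⟩ := key h' h
  refine ⟨rfl, ?_⟩
  rcases h1 with rfl | h1
  · rcases h2 with h2 | h2 <;> exact h2.symm
  · exact h1

/-- The components of the pairs in a set form a set. -/
theorem exists_field (f : M) : ∃ u : M, ∀ x y, PairMem f x y → x ε u ∧ y ε u := by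
  obtain ⟨g, hg⟩ := exists_union f
  obtain ⟨u, hu⟩ := exists_union g
  refine ⟨u, fun x y ⟨p, hpf, hp⟩ => ?_⟩
  obtain ⟨d, hd⟩ := exists_isPair x y
  have hdg : d ε g := (hg d).2 ⟨p, hpf, (hp d).2 (Or.inr hd)⟩
  exact ⟨(hu x).2 ⟨d, hdg, (hd x).2 (Or.inl rfl)⟩, (hu y).2 ⟨d, hdg, (hd y).2 (Or.inr rfl)⟩⟩

variable {n : ℕ} {r s t : (Fin n → M) → M} {A : (Fin n → M) → M → M → Prop}

/-- The unbounded quantifier in the definition is traded for one bounded by the pair, together with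
the membership of both components. The instances for ordered pairs and successors follow the same
pattern. -/
instance [IsVar r] [IsVar s] [IsVar t] : Definable fun v => IsPair (r v) (s v) (t v) :=
  .congr (P := fun v => (∀ u, u ε r v → u = s v ∨ u = t v) ∧ s v ε r v ∧ t v ε r v)
    inferInstance fun v => ⟨fun h u => ⟨h.1 u, by rintro (rfl | rfl); exacts [h.2.1, h.2.2]⟩,
      fun h => ⟨fun u => (h u).1, (h _).2 (Or.inl rfl), (h _).2 (Or.inr rfl)⟩⟩

instance [IsVar r] [IsVar s] [IsVar t] : Definable fun v => IsOrdPair (r v) (s v) (t v) :=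
  .congr (P := fun v => (∀ u, u ε r v → IsPair u (s v) (s v) ∨ IsPair u (s v) (t v)) ∧
    (∃ u, u ε r v ∧ IsPair u (s v) (s v)) ∧ ∃ u, u ε r v ∧ IsPair u (s v) (t v))
    inferInstance fun v => by
      refine ⟨fun ⟨h, ⟨a, ha, ha'⟩, b, hb, hb'⟩ u => ⟨h u, ?_⟩, fun h => ⟨fun u => (h u).1, ?_, ?_⟩⟩
      · rintro (hu | hu)
        · exact hu.unique ha' ▸ ha
        · exact hu.unique hb' ▸ hb
      · obtain ⟨a, ha⟩ := exists_isPair (s v) (s v)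
        exact ⟨a, (h a).2 (Or.inl ha), ha⟩
      · obtain ⟨a, ha⟩ := exists_isPair (s v) (t v)
        exact ⟨a, (h a).2 (Or.inr ha), ha⟩

instance [IsVar r] [IsVar s] [IsVar t] : Definable fun v => PairMem (r v) (s v) (t v) :=
  inferInstanceAs (Definable fun v => ∃ p, p ε r v ∧ IsOrdPair p (s v) (t v))

instance [IsVar s] : Definable fun v => IsEmptySet (s v) :=
  inferInstanceAs (Definable fun v => ∀ x, x ε s v → False)

instance [IsVar s] [IsVar t] : Definable fun v => IsSucc (s v) (t v) :=
  .congr (P := fun v => (∀ u, u ε s v → u ε t v ∨ u = t v) ∧ (∀ u, u ε t v → u ε s v) ∧ t v ε s v)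
    inferInstance fun v => ⟨fun h u => ⟨h.1 u, by rintro (hu | rfl); exacts [h.2.1 u hu, h.2.2]⟩,
      fun h => ⟨fun u => (h u).1, fun u hu => (h u).2 (Or.inl hu), (h _).2 (Or.inr rfl)⟩⟩

instance [IsVar s] : Definable fun v => IsInductive (s v) :=
  .congr (P := fun v => (∃ e, e ε s v ∧ IsEmptySet e) ∧ ∀ x, x ε s v → ∃ y, y ε s v ∧ IsSucc y x)
    inferInstance fun v => by simp only [IsInductive, and_comm (b := _ ε s v)]

/-- The components of an ordered pair are elements of elements of it, so quantifiers over them can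
be bounded. -/
theorem exists_isOrdPair_iff {B : M → M → Prop} (p : M) :
    (∃ x y, IsOrdPair p x y ∧ B x y) ↔
      ∃ q, q ε p ∧ ∃ x, x ε q ∧ ∃ q', q' ε p ∧ ∃ y, y ε q' ∧ (IsOrdPair p x y ∧ B x y) := by
  refine ⟨fun ⟨x, y, h⟩ => ?_, fun ⟨_, _, x, _, _, _, y, _, h⟩ => ⟨x, y, h⟩⟩
  obtain ⟨d, hd⟩ := exists_isPair x y
  have hdt := (h.1 d).2 (Or.inr hd)
  exact ⟨d, hdt, x, (hd x).2 (Or.inl rfl), d, hdt, y, (hd y).2 (Or.inr rfl), h⟩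

instance [ht : IsVar t] [Definable fun w : Fin (n + 4) → M =>
    A (fun i => w i.castSucc.castSucc.castSucc.castSucc) (w (Fin.last (n + 1)).castSucc.castSucc)
      (w (Fin.last (n + 3)))] :
    Definable fun v => ∃ x y, IsOrdPair (t v) x y ∧ A v x y := by
  simp only [exists_isOrdPair_iff]
  obtain ⟨a | i, h⟩ := ht.exists_var
  · obtain rfl : (fun _ => a) = t := funext h
    infer_instance
  · obtain rfl : (fun v => v i) = t := funext h
    infer_instance

end Pairs

/-! ### The set of natural numbers and its induction principles -/

section Omega

variable {M : Type} [setLang.Structure M] [KPModel M]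

theorem IsEmptySet.unique {e e' : M} (h : IsEmptySet e) (h' : IsEmptySet e') : e = e' :=
  ext fun u => iff_of_false (h u) (h' u)

theorem IsSucc.unique {s s' x : M} (h : IsSucc s x) (h' : IsSucc s' x) : s = s' :=
  ext fun u => (h u).trans (h' u).symm

theorem mem_asymm {x y : M} (h : x ε y) (h' : y ε x) : False := by
  refine set_induction (fun x : M => ∀ y, y ε x → ¬ x ε y) (fun x ih y hy hxy => ?_) x y h' h
  exact ih y hy x hxy hy

theorem IsSucc.inj {s x x' : M} (h : IsSucc s x) (h' : IsSucc s x') : x = x' := by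
  rcases (h' x).1 h.self_mem with h1 | h1
  · rcases (h x').1 h'.self_mem with h2 | h2
    · exact (mem_asymm h1 h2).elim
    · exact h2.symm
  · exact h1

/-- `ω` is the intersection of all inductive subsets of a given inductive set `I`; the quantifier
over subsets of `I` is allowed in Separation. An arbitrary inductive `u` is handled through `I ∩ u`.
-/
theorem exists_isOmega (M : Type) [setLang.Structure M] [KPModel M] : ∃ w : M, IsOmega w := by
  obtain ⟨I, hI⟩ := exists_isInductive M
  obtain ⟨w, hw⟩ := exists_sep (fun x => ∀ J, Sub J I → IsInductive J → x ε J) I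
  refine ⟨w, ⟨?_, fun x hx => ?_⟩, fun u hu x hx => ?_⟩
  · obtain ⟨e, he, heI⟩ := hI.1
    refine ⟨e, he, (hw e).2 ⟨heI, fun J _ hJ => ?_⟩⟩
    obtain ⟨e', he', heJ⟩ := hJ.1
    exact he.unique he' ▸ heJ
  · obtain ⟨s, hs, hsI⟩ := hI.2 x ((hw x).1 hx).1
    refine ⟨s, hs, (hw s).2 ⟨hsI, fun J hJI hJ => ?_⟩⟩
    obtain ⟨s', hs', hsJ⟩ := hJ.2 x (((hw x).1 hx).2 J hJI hJ)
    exact hs.unique hs' ▸ hsJ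
  · obtain ⟨J, hJ⟩ := exists_sep (fun x => x ε u) I
    refine ((hJ x).1 (((hw x).1 hx).2 J (fun y hy => ((hJ y).1 hy).1) ⟨?_, fun y hy => ?_⟩)).2
    · obtain ⟨e, he, heI⟩ := hI.1
      obtain ⟨e', he', heu⟩ := hu.1
      exact ⟨e, he, (hJ e).2 ⟨heI, he.unique he' ▸ heu⟩⟩
    · obtain ⟨s, hs, hsI⟩ := hI.2 y ((hJ y).1 hy).1
      obtain ⟨s', hs', hsu⟩ := hu.2 y ((hJ y).1 hy).2
      exact ⟨s, hs, (hJ s).2 ⟨hsI, hs.unique hs' ▸ hsu⟩⟩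

variable {w : M}

theorem IsOmega.induction (hw : IsOmega w) (P : M → Prop)
    [Definable fun v : Fin 1 → M => P (v 0)] (h0 : ∀ e, IsEmptySet e → e ε w → P e)
    (hs : ∀ m n, m ε w → IsSucc n m → n ε w → P m → P n) : ∀ n, n ε w → P n := by
  obtain ⟨J, hJ⟩ := exists_sep P w
  refine fun n hn => ((hJ n).1 (hw.2 J ⟨?_, fun m hm => ?_⟩ n hn)).2
  · obtain ⟨e, he, hew⟩ := hw.1.1
    exact ⟨e, he, (hJ e).2 ⟨hew, h0 e he hew⟩⟩
  · obtain ⟨hmw, hm⟩ := (hJ m).1 hm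
    obtain ⟨s, hsm, hsw⟩ := hw.1.2 m hmw
    exact ⟨s, hsm, (hJ s).2 ⟨hsw, hs m s hmw hsm hsw hm⟩⟩

theorem IsOmega.cases (hw : IsOmega w) {n : M} (hn : n ε w) :
    IsEmptySet n ∨ ∃ m, m ε w ∧ IsSucc n m :=
  hw.induction (fun n => IsEmptySet n ∨ ∃ m, m ε w ∧ IsSucc n m) (fun _ he _ => Or.inl he)
    (fun m _ hm hnm _ _ => Or.inr ⟨m, hm, hnm⟩) n hn

/-- Separation cannot form the set of `n` with a `Σ₁^𝒫` property, so this rests on set induction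
instead of the minimality of `ω`. -/
theorem IsOmega.sigma_induction (hw : IsOmega w) (R : M → M → Prop)
    [Definable fun v : Fin 2 → M => R (v 0) (v 1)]
    (h0 : ∀ e, IsEmptySet e → e ε w → ∃ s, R e s)
    (hs : ∀ m n, m ε w → IsSucc n m → n ε w → (∃ s, R m s) → ∃ s, R n s) {n : M} (hn : n ε w) :
    ∃ s, R n s := by
  -- The condition `n ∈ ω` goes inside the existential quantifier, which keeps the induction formula
  -- `Σ₁^𝒫`. Off `ω` any witness will do.
  suffices h : ∃ s, n ε w → R n s from h.imp fun _ h => h hn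
  refine PowerKP.sigma_induction (fun n s => n ε w → R n s) (fun n ih => ?_) n
  by_cases hnw : n ε w
  · rcases hw.cases hnw with h | ⟨m, hm, hnm⟩
    · exact (h0 n h hnw).imp fun _ h _ => h
    · exact (hs m n hm hnm hnw ((ih m hnm.self_mem).imp fun _ h => h hm)).imp fun _ h _ => h
  · exact ⟨n, fun h => absurd h hnw⟩

end Omega

/-! ## Recursion on the natural numbers -/

section Recursion

variable {M : Type} [setLang.Structure M]

/-- Every element of `s` is a pair `⟨0, z⟩`, or a pair `⟨i + 1, y⟩` with `G(x, y)` for some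
`⟨i, x⟩ ∈ s`. -/
def IsApprox (w z : M) (G : M → M → Prop) (s : M) : Prop :=
  ∀ p, p ε s → ∃ n y, IsOrdPair p n y ∧ (n ε w ∧ (IsEmptySet n ∧ y = z ∨
    ∃ q, q ε s ∧ ∃ i x, IsOrdPair q i x ∧ (IsSucc n i ∧ G x y)))

variable {w z : M} {G : M → M → Prop}

theorem IsApprox.cases {s n y : M} [KPModel M] (hs : IsApprox w z G s) (h : PairMem s n y) :
    n ε w ∧ (IsEmptySet n ∧ y = z ∨ ∃ i x, PairMem s i x ∧ IsSucc n i ∧ G x y) := by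
  obtain ⟨p, hps, hp⟩ := h
  obtain ⟨n', y', hp', hn, h⟩ := hs p hps
  obtain ⟨rfl, rfl⟩ := hp.inj hp'
  exact ⟨hn, h.imp_right fun ⟨q, hqs, i, x, hq, h⟩ => ⟨i, x, ⟨q, hqs, hq⟩, h⟩⟩

/-- Approximations are not required to be functions, only to justify each of their pairs. Hence any
union of approximations is one, with no compatibility to check. -/
theorem isApprox_of_forall {s : M} (h : ∀ p, p ε s → ∃ s', IsApprox w z G s' ∧ Sub s' s ∧ p ε s') :
    IsApprox w z G s := by
  intro p hp
  obtain ⟨s', hs', hsub, hps'⟩ := h p hp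
  obtain ⟨n, y, hpn, hn, h⟩ := hs' p hps'
  exact ⟨n, y, hpn, hn, h.imp_right fun ⟨q, hq, h⟩ => ⟨q, hsub q hq, h⟩⟩

theorem IsApprox.insert {s s' p n y : M} (hs : IsApprox w z G s)
    (hs' : ∀ q, q ε s' ↔ q ε s ∨ q = p) (hp : IsOrdPair p n y) (hn : n ε w)
    (h : IsEmptySet n ∧ y = z ∨ ∃ i x, PairMem s i x ∧ IsSucc n i ∧ G x y) :
    IsApprox w z G s' := by
  have hsub : Sub s s' := fun q hq => (hs' q).2 (Or.inl hq)
  intro q hq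
  rcases (hs' q).1 hq with hq | rfl
  · obtain ⟨n, y, hqn, hn, h⟩ := hs q hq
    exact ⟨n, y, hqn, hn, h.imp_right fun ⟨r, hr, h⟩ => ⟨r, hsub r hr, h⟩⟩
  · exact ⟨n, y, hp, hn, h.imp_right fun ⟨i, x, ⟨r, hr, hr'⟩, h⟩ => ⟨r, hsub r hr, i, x, hr', h⟩⟩

variable [KPModel M]

instance [DefinableRel G] {n : ℕ} {t : (Fin n → M) → M} [IsVar t] :
    Definable fun v => IsApprox w z G (t v) :=
  have : Definable fun v : Fin 1 → M => IsApprox w z G (v 0) :=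
    inferInstanceAs (Definable fun v : Fin 1 → M => ∀ p, p ε v 0 → ∃ n y, IsOrdPair p n y ∧
      (n ε w ∧ (IsEmptySet n ∧ y = z ∨
        ∃ q, q ε v 0 ∧ ∃ i x, IsOrdPair q i x ∧ (IsSucc n i ∧ G x y))))
  Definable.comp (IsApprox w z G) t

instance : DefinableRel fun s x : M => ∃ y, PairMem s x y where
  definable := .congr (P := fun v : Fin 2 → M => ∃ p, p ε v 0 ∧ ∃ x y, IsOrdPair p x y ∧ x = v 1)
    inferInstance fun v => by
      constructor
      · rintro ⟨p, hps, x, y, hp, rfl⟩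
        exact ⟨y, p, hps, hp⟩
      · rintro ⟨y, p, hps, hp⟩
        exact ⟨p, hps, _, y, hp, rfl⟩

instance {n : ℕ} {s t : (Fin n → M) → M} [IsVar s] [IsVar t] :
    Definable fun v => ∃ y, PairMem (s v) (t v) y :=
  DefinableRel.comp fun s x : M => ∃ y, PairMem s x y

/-- `Σ₁^𝒫` induction on `n`, adding one pair at each step. -/
theorem IsOmega.exists_isApprox [DefinableRel G] (hw : IsOmega w) (hG : ∀ x, ∃ y, G x y) (z : M)
    {n : M} (hn : n ε w) : ∃ s, IsApprox w z G s ∧ ∃ y, PairMem s n y := by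
  refine hw.sigma_induction (fun n s => IsApprox w z G s ∧ ∃ y, PairMem s n y) ?_ ?_ hn
  · intro e he hew
    obtain ⟨p, hp⟩ := exists_isOrdPair e z
    -- Here `e = ∅` doubles as the empty approximation.
    obtain ⟨s, hs⟩ := exists_insert e p
    refine ⟨s, IsApprox.insert (s := e) (fun q hq => absurd hq (he q)) hs hp hew
      (Or.inl ⟨he, rfl⟩), z, p, (hs p).2 (Or.inr rfl), hp⟩
  · rintro m n hm hnm hn ⟨s, hs, x, hx⟩
    obtain ⟨y, hy⟩ := hG x
    obtain ⟨p, hp⟩ := exists_isOrdPair n y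
    obtain ⟨s', hs'⟩ := exists_insert s p
    exact ⟨s', hs.insert hs' hp hn (Or.inr ⟨m, x, hx, hnm, hy⟩), y, p, (hs' p).2 (Or.inr rfl), hp⟩

theorem IsOmega.isApprox_unique [DefinableRel G] (hw : IsOmega w)
    (hG : ∀ x y y', G x y → G x y' → y = y') {f : M} (hf : IsApprox w z G f) {n y y' : M}
    (hy : PairMem f n y) (hy' : PairMem f n y') : y = y' := by
  -- Bounding `y` and `y'` by the field of `f` makes the induction statement `Δ₀^𝒫`.
  obtain ⟨u, hu⟩ := exists_field f
  refine hw.induction (fun n => ∀ y, y ε u → ∀ y', y' ε u → PairMem f n y → PairMem f n y' →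
    y = y') ?_ ?_ n (hf.cases hy).1 y (hu n y hy).2 y' (hu n y' hy').2 hy hy'
  · intro e he _ y _ y' _ hy hy'
    rcases (hf.cases hy).2 with h | ⟨i, x, -, h, -⟩
    · rcases (hf.cases hy').2 with h' | ⟨i, x, -, h', -⟩
      · exact h.2.trans h'.2.symm
      · exact absurd h'.self_mem (he i)
    · exact absurd h.self_mem (he i)
  · intro m n _ hnm _ ih y _ y' _ hy hy'
    rcases (hf.cases hy).2 with h | ⟨i, x, hx, h, hxy⟩
    · exact absurd hnm.self_mem (h.1 m)
    · rcases (hf.cases hy').2 with h' | ⟨i', x', hx', h', hxy'⟩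
      · exact absurd hnm.self_mem (h'.1 m)
      · obtain rfl := hnm.inj h
        obtain rfl := hnm.inj h'
        obtain rfl := ih x (hu _ _ hx).2 x' (hu _ _ hx').2 hx hx'
        exact hG x y y' hxy hxy'

/-- Definition of a function by recursion on `ω`. -/
theorem IsOmega.exists_recursion (hw : IsOmega w) (G : M → M → Prop) [DefinableRel G]
    (hG : ∀ x, ∃ y, G x y) (hG' : ∀ x y y', G x y → G x y' → y = y') (z : M) :
    ∃ f, IsFunctionOn f w ∧ (∃ e, IsEmptySet e ∧ PairMem f e z) ∧
      ∀ n, n ε w → ∃ s, IsSucc s n ∧ ∃ x y, PairMem f n x ∧ PairMem f s y ∧ G x y := by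
  -- Collection may put other sets into `B`, so the approximations are separated out before taking
  -- the union.
  obtain ⟨B, hB⟩ := collect (fun n s => IsApprox w z G s ∧ ∃ y, PairMem s n y)
    (fun n hn => hw.exists_isApprox hG z hn)
  obtain ⟨C, hC⟩ := exists_sep (fun s => IsApprox w z G s) B
  obtain ⟨f, hf⟩ := exists_union C
  have happ : IsApprox w z G f := isApprox_of_forall fun p hp => by
    obtain ⟨s, hs, hps⟩ := (hf p).1 hp
    exact ⟨s, ((hC s).1 hs).2, fun q hq => (hf q).2 ⟨s, hs, hq⟩, hps⟩
  have htot : ∀ n, n ε w → ∃ y, PairMem f n y := by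
    intro n hn
    obtain ⟨s, hsB, hs, y, p, hps, hp⟩ := hB n hn
    exact ⟨y, p, (hf p).2 ⟨s, (hC s).2 ⟨hsB, hs⟩, hps⟩, hp⟩
  refine ⟨f, ⟨⟨fun p hp => ?_, fun n y y' => hw.isApprox_unique hG' happ⟩,
    fun n => ⟨htot n, fun ⟨y, hy⟩ => (happ.cases hy).1⟩⟩, ?_, fun n hn => ?_⟩
  · obtain ⟨n, y, h, -⟩ := happ p hp
    exact ⟨n, y, h⟩
  · obtain ⟨e, he, hew⟩ := hw.1.1
    obtain ⟨y, hy⟩ := htot e hew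
    rcases (happ.cases hy).2 with h | ⟨i, x, -, h, -⟩
    · exact ⟨e, he, h.2 ▸ hy⟩
    · exact absurd h.self_mem (he i)
  · obtain ⟨s, hs, hsw⟩ := hw.1.2 n hn
    obtain ⟨y, hy⟩ := htot s hsw
    rcases (happ.cases hy).2 with h | ⟨i, x, hx, h, hxy⟩
    · exact absurd hs.self_mem (h.1 n)
    · obtain rfl := hs.inj h
      exact ⟨s, hs, x, y, hx, hy, hxy⟩

end Recursion

/-! ## The cumulative hierarchy -/

section Levels

variable {M : Type} [setLang.Structure M]

theorem Sub.refl (x : M) : Sub x x := fun _ => id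

theorem Sub.trans {x y z : M} (h : Sub x y) (h' : Sub y z) : Sub x z := fun u hu => h' u (h u hu)

/-- `h` is an initial segment of the cumulative hierarchy: every `v ∈ h` is the set of all subsets
of elements of `h ∩ v`. -/
def IsHistory (h : M) : Prop :=
  ∀ v, v ε h → (∀ x, x ε v → ∃ c, c ε h ∧ (c ε v ∧ Sub x c)) ∧
    ∀ c, c ε h → c ε v → ∀ x, Sub x c → x ε v

/-- `v` is a level `V_α` of the cumulative hierarchy: the set of all subsets of elements of some
history. -/
def IsLevel (v : M) : Prop :=
  ∃ h, Sub h v ∧ (IsHistory h ∧ (∀ x, x ε v → ∃ c, c ε h ∧ Sub x c) ∧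
    ∀ c, c ε h → ∀ x, Sub x c → x ε v)

instance {n : ℕ} {t : (Fin n → M) → M} [IsVar t] : Definable fun v => IsHistory (t v) :=
  have : Definable fun v : Fin 1 → M => IsHistory (v 0) :=
    inferInstanceAs (Definable fun v : Fin 1 → M => ∀ u, u ε v 0 →
      (∀ x, x ε u → ∃ c, c ε v 0 ∧ (c ε u ∧ Sub x c)) ∧
        ∀ c, c ε v 0 → c ε u → ∀ x, Sub x c → x ε u)
  Definable.comp IsHistory t

/-- The history of a level is a subset of the level, so the quantifier over histories is of the form
`∃ h ⊆ v`. -/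
instance {n : ℕ} {t : (Fin n → M) → M} [IsVar t] : Definable fun v => IsLevel (t v) :=
  have : Definable fun v : Fin 1 → M => IsLevel (v 0) :=
    inferInstanceAs (Definable fun v : Fin 1 → M => ∃ h, Sub h (v 0) ∧ (IsHistory h ∧
      (∀ x, x ε v 0 → ∃ c, c ε h ∧ Sub x c) ∧ ∀ c, c ε h → ∀ x, Sub x c → x ε v 0))
  Definable.comp IsLevel t

theorem IsLevel.mem_of_sub {v x y : M} (hv : IsLevel v) (hy : y ε v) (hxy : Sub x y) : x ε v := by
  obtain ⟨h, -, -, h1, h2⟩ := hv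
  obtain ⟨c, hc, hyc⟩ := h1 y hy
  exact h2 c hc x (hxy.trans hyc)

variable [KPModel M]

theorem IsHistory.trans {h v : M} (hh : IsHistory h) (hv : v ε h) :
    ∀ x, x ε v → Sub x v := by
  refine set_induction (fun v : M => v ε h → ∀ x, x ε v → Sub x v) (fun v ih hv x hx y hy => ?_)
    v hv
  obtain ⟨c, hc, hcv, hxc⟩ := (hh v hv).1 x hx
  exact (hh v hv).2 c hc hcv y (ih c hcv hc y (hxc y hy))

theorem IsLevel.trans {v x : M} (hv : IsLevel v) (hx : x ε v) : Sub x v := by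
  obtain ⟨h, -, hh, h1, h2⟩ := hv
  obtain ⟨c, hc, hxc⟩ := h1 x hx
  exact fun y hy => h2 c hc y (hh.trans hc y (hxc y hy))

/-- The history of `v` is `h ∩ v`; transitivity of `v` keeps the required elements inside. -/
theorem IsHistory.isLevel {h v : M} (hh : IsHistory h) (hv : v ε h) : IsLevel v := by
  obtain ⟨g, hg⟩ := exists_sep (fun x => x ε v) h
  refine ⟨g, fun x hx => ((hg x).1 hx).2, fun u hu => ?_, fun x hx => ?_, fun c hc x hx => ?_⟩
  · obtain ⟨huh, huv⟩ := (hg u).1 hu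
    refine ⟨fun x hx => ?_, fun c hc => (hh u huh).2 c ((hg c).1 hc).1⟩
    obtain ⟨c, hc, hcu, hxc⟩ := (hh u huh).1 x hx
    exact ⟨c, (hg c).2 ⟨hc, hh.trans hv u huv c hcu⟩, hcu, hxc⟩
  · obtain ⟨c, hc, hcv, hxc⟩ := (hh v hv).1 x hx
    exact ⟨c, (hg c).2 ⟨hc, hcv⟩, hxc⟩
  · exact (hh v hv).2 c ((hg c).1 hc).1 ((hg c).1 hc).2 x hx

theorem IsLevel.exists_level {v x : M} (hv : IsLevel v) (hx : x ε v) :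
    ∃ c, IsLevel c ∧ c ε v ∧ Sub x c := by
  obtain ⟨h, hhv, hh, h1, -⟩ := hv
  obtain ⟨c, hc, hxc⟩ := h1 x hx
  exact ⟨c, hh.isLevel hc, hhv c hc, hxc⟩

/-- Double induction on membership. If `s` and `t` are incomparable, then each smaller level in one
belongs to the other, so the two contain the same subsets of levels and are equal. -/
theorem IsLevel.comparable {s t : M} (hs : IsLevel s) (ht : IsLevel t) :
    s ε t ∨ s = t ∨ t ε s := by
  -- The transitive set `t ∪ {t}` bounds the quantifier over the second level, so that the outer
  -- induction is on a `Δ₀^𝒫` property.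
  obtain ⟨t', ht'⟩ := exists_insert t t
  have htr : ∀ u, u ε t' → Sub u t' := by
    intro u hu x hx
    refine (ht' x).2 (Or.inl ?_)
    rcases (ht' u).1 hu with hu | rfl
    · exact ht.trans hu x hx
    · exact hx
  refine set_induction (fun s : M => IsLevel s → ∀ t, t ε t' → IsLevel t → s ε t ∨ s = t ∨ t ε s)
    (fun s ihs hs => ?_) s hs t ((ht' t).2 (Or.inr rfl)) ht
  refine set_induction (fun t : M => t ε t' → IsLevel t → s ε t ∨ s = t ∨ t ε s)
    (fun t iht htt' ht => ?_)
  by_contra! hcon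
  refine hcon.2.1 (ext fun x => ⟨fun hx => ?_, fun hx => ?_⟩)
  · obtain ⟨c, hc, hcs, hxc⟩ := hs.exists_level hx
    rcases ihs c hcs hc t htt' ht with h | rfl | h
    · exact ht.mem_of_sub h hxc
    · exact absurd hcs hcon.2.2
    · exact absurd (hs.trans hcs t h) hcon.2.2
  · obtain ⟨c, hc, hct, hxc⟩ := ht.exists_level hx
    rcases iht c hct (htr t htt' c hct) hc with h | rfl | h
    · exact absurd (ht.trans hct s h) hcon.1
    · exact absurd hct hcon.1
    · exact hs.mem_of_sub h hxc

/-- Every set is included in a level. -/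
theorem exists_isLevel_sub (x : M) : ∃ v, IsLevel v ∧ Sub x v := by
  refine sigma_induction (fun x v => IsLevel v ∧ Sub x v) (fun x ih => ?_) x
  -- `Z` will consist of levels and cover every element of `x`. The new level `V` is the set of all
  -- subsets of members of `Z`; its history `h` consists of the levels in `Z` or in a member of `Z`.
  obtain ⟨B, hB⟩ := collect (fun x v => IsLevel v ∧ Sub x v) ih
  obtain ⟨Z, hZ⟩ := exists_sep (fun v => IsLevel v) B
  obtain ⟨U, hU⟩ := exists_union Z
  obtain ⟨p, hp⟩ := exists_isPair Z U
  obtain ⟨W, hW⟩ := exists_union p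
  obtain ⟨h, hh⟩ := exists_sep (fun v => IsLevel v) W
  have hmem : ∀ c, c ε h ↔ IsLevel c ∧ (c ε Z ∨ ∃ v, v ε Z ∧ c ε v) := by
    intro c
    rw [hh, hW, and_comm, ← hU]
    refine and_congr_right' ⟨?_, ?_⟩
    · rintro ⟨y, hy, hc⟩
      rcases (hp y).1 hy with rfl | rfl
      exacts [Or.inl hc, Or.inr hc]
    · rintro (hc | hc)
      exacts [⟨Z, (hp Z).2 (Or.inl rfl), hc⟩, ⟨U, (hp U).2 (Or.inr rfl), hc⟩]
  have hlev : ∀ v, v ε Z → IsLevel v := fun v hv => ((hZ v).1 hv).2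
  obtain ⟨P, hP⟩ := exists_powerset U
  obtain ⟨V, hV⟩ := exists_sep (fun y => ∃ v, v ε Z ∧ Sub y v) P
  have hmemV : ∀ y, y ε V ↔ ∃ v, v ε Z ∧ Sub y v := fun y => (hV y).trans
    ⟨And.right, fun ⟨v, hv, hy⟩ => ⟨(hP y).2 fun u hu => (hU u).2 ⟨v, hv, hy u hu⟩, v, hv, hy⟩⟩
  have hsub : ∀ c, c ε h → ∃ v, v ε Z ∧ Sub c v := by
    intro c hc
    rcases ((hmem c).1 hc).2 with hcZ | ⟨v, hv, hcv⟩
    · exact ⟨c, hcZ, .refl c⟩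
    · exact ⟨v, hv, (hlev v hv).trans hcv⟩
  refine ⟨V, ⟨h, fun c hc => (hmemV c).2 (hsub c hc), fun v hv => ?_, fun y hy => ?_,
    fun c hc y hy => ?_⟩, fun y hy => ?_⟩
  · obtain ⟨hvl, hvZ⟩ := (hmem v).1 hv
    refine ⟨fun y hy => ?_, fun c _ hcv y hy => hvl.mem_of_sub hcv hy⟩
    obtain ⟨c, hc, hcv, hyc⟩ := hvl.exists_level hy
    refine ⟨c, (hmem c).2 ⟨hc, Or.inr ?_⟩, hcv, hyc⟩
    obtain ⟨u, hu, hvu⟩ := hsub v hv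
    exact ⟨u, hu, hvu c hcv⟩
  · obtain ⟨v, hv, hyv⟩ := (hmemV y).1 hy
    exact ⟨v, (hmem v).2 ⟨hlev v hv, Or.inl hv⟩, hyv⟩
  · obtain ⟨v, hv, hcv⟩ := hsub c hc
    exact (hmemV y).2 ⟨v, hv, hy.trans hcv⟩
  · obtain ⟨v, hvB, hv, hyv⟩ := hB y hy
    exact (hmemV y).2 ⟨v, (hZ v).2 ⟨hvB, hv⟩, hyv⟩

/-- If some level satisfies `P`, then there is a least one. -/
theorem exists_least_level (P : M → Prop) [Definable fun v : Fin 1 → M => P (v 0)] {v : M}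
    (hv : IsLevel v) (hPv : P v) :
    ∃ u, IsLevel u ∧ P u ∧ ∀ u', u' ε u → ¬ (IsLevel u' ∧ P u') := by
  by_contra! hcon
  refine set_induction (fun v => ¬ (IsLevel v ∧ P v)) (fun x ih hx => ?_) v ⟨hv, hPv⟩
  obtain ⟨u', hu', h⟩ := hcon x hx.1 hx.2
  exact ih u' hu' h

end Levels

/-! ## Dependent choice -/

section DependentChoice

variable {M : Type} [setLang.Structure M]

/-- `Y` is the least level in which every element of `X` has an `R`-successor. -/
def IsNextLevel (R : M → M → Prop) (X Y : M) : Prop :=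
  IsLevel Y ∧ (∀ x, x ε X → ∃ y, y ε Y ∧ R x y) ∧
    ∀ Y', Y' ε Y → ¬ (IsLevel Y' ∧ ∀ x, x ε X → ∃ y, y ε Y' ∧ R x y)

/-- `y` is the value at `{u ∈ A : R(x, u)}` of the function `c` if `x ∈ A`, and `x` otherwise. -/
def IsChosen (R : M → M → Prop) (A c x y : M) : Prop :=
  x ε A ∧ (∃ S, Sub S A ∧ ((∀ u, u ε S → R x u) ∧ (∀ u, u ε A → R x u → u ε S) ∧
    PairMem c S y)) ∨ ¬ x ε A ∧ y = x

variable [KPModel M] {R : M → M → Prop}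

/-- By comparability, two distinct candidates would have one belonging to the other, against
minimality. -/
theorem IsNextLevel.unique {X Y Y' : M} (h : IsNextLevel R X Y) (h' : IsNextLevel R X Y') :
    Y = Y' := by
  rcases h.1.comparable h'.1 with h1 | h1 | h1
  · exact absurd ⟨h.1, h.2.1⟩ (h'.2.2 Y h1)
  · exact h1
  · exact absurd ⟨h'.1, h'.2.1⟩ (h.2.2 Y' h1)

/-- For `x ∈ A` the argument of `c` is determined by extensionality. -/
theorem IsChosen.unique {A c x y y' : M} (hc : IsFunction c) (h : IsChosen R A c x y)
    (h' : IsChosen R A c x y') : y = y' := by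
  rcases h with ⟨hx, S, hSA, hS, hS', hy⟩ | ⟨hx, rfl⟩
  · rcases h' with ⟨-, T, hTA, hT, hT', hy'⟩ | ⟨hx', -⟩
    · obtain rfl : S = T := ext fun u =>
        ⟨fun hu => hT' u (hSA u hu) (hS u hu), fun hu => hS' u (hTA u hu) (hT u hu)⟩
      exact hc.2 S y y' hy hy'
    · exact absurd hx hx'
  · rcases h' with ⟨hx', -⟩ | ⟨-, rfl⟩
    · exact absurd hx' hx
    · rfl

variable (R) [DefinableRel R]

instance : DefinableRel (IsNextLevel R) :=
  ⟨inferInstanceAs (Definable fun v : Fin 2 → M => IsLevel (v 1) ∧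
    (∀ x, x ε v 0 → ∃ y, y ε v 1 ∧ R x y) ∧
      ∀ Y', Y' ε v 1 → ¬ (IsLevel Y' ∧ ∀ x, x ε v 0 → ∃ y, y ε Y' ∧ R x y))⟩

instance (A c : M) : DefinableRel (IsChosen R A c) :=
  ⟨inferInstanceAs (Definable fun v : Fin 2 → M => v 0 ε A ∧ (∃ S, Sub S A ∧
    ((∀ u, u ε S → R (v 0) u) ∧ (∀ u, u ε A → R (v 0) u → u ε S) ∧ PairMem c S (v 1))) ∨
      ¬ v 0 ε A ∧ v 1 = v 0)⟩

variable {R}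

/-- Collection bounds the successors by a set, some level includes that set, and set induction
yields a least suitable level. -/
theorem exists_isNextLevel (hR : ∀ x, ∃ y, R x y) (X : M) : ∃ Y, IsNextLevel R X Y := by
  obtain ⟨B, hB⟩ := collect R (a := X) fun x _ => hR x
  obtain ⟨v, hv, hBv⟩ := exists_isLevel_sub B
  refine exists_least_level (fun Y => ∀ x, x ε X → ∃ y, y ε Y ∧ R x y) hv fun x hx => ?_
  obtain ⟨y, hy, hxy⟩ := hB x hx
  exact ⟨y, hBv y hy, hxy⟩

/-- Every set belongs to a set that is closed under `R`-successors. -/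
theorem exists_closed (hR : ∀ x, ∃ y, R x y) (z : M) :
    ∃ A : M, z ε A ∧ ∀ x, x ε A → ∃ y, y ε A ∧ R x y := by
  obtain ⟨w, hw⟩ := exists_isOmega M
  obtain ⟨X₀, hX₀⟩ := exists_isPair z z
  obtain ⟨f, hf, ⟨e, -, hfe⟩, hfs⟩ := hw.exists_recursion (IsNextLevel R) (exists_isNextLevel hR)
    (fun _ _ _ => IsNextLevel.unique) X₀
  obtain ⟨u, hu⟩ := exists_field f
  obtain ⟨U, hU⟩ := exists_union u
  -- `A` is the union of the values of `f`. The values need not increase: an element of one has a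
  -- successor in the next.
  obtain ⟨A, hA⟩ := exists_sep (fun x => ∃ p, p ε f ∧ ∃ n X, IsOrdPair p n X ∧ x ε X) U
  have hmem : ∀ x, x ε A ↔ ∃ n X, PairMem f n X ∧ x ε X := by
    refine fun x => (hA x).trans ⟨?_, ?_⟩
    · rintro ⟨-, p, hpf, n, X, hp, hx⟩
      exact ⟨n, X, ⟨p, hpf, hp⟩, hx⟩
    · rintro ⟨n, X, ⟨p, hpf, hp⟩, hx⟩
      exact ⟨(hU x).2 ⟨X, (hu n X ⟨p, hpf, hp⟩).2, hx⟩, p, hpf, n, X, hp, hx⟩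
  refine ⟨A, (hmem z).2 ⟨e, X₀, hfe, (hX₀ z).2 (Or.inl rfl)⟩, fun x hx => ?_⟩
  obtain ⟨n, X, hnX, hx⟩ := (hmem x).1 hx
  obtain ⟨s, -, X', Y, hnX', hsY, h⟩ := hfs n ((hf.2 n).2 ⟨X, hnX⟩)
  obtain rfl := hf.1.2 n X X' hnX hnX'
  obtain ⟨y, hy, hxy⟩ := h.2.1 x hx
  exact ⟨y, (hmem y).2 ⟨s, Y, hsY, hy⟩, hxy⟩

/-- The default value outside `A` makes the relation total on the whole model, as the recursion
theorem demands. -/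
theorem exists_isChosen {A P c : M} (hA : ∀ x, x ε A → ∃ y, y ε A ∧ R x y)
    (hP : ∀ x, x ε P ↔ Sub x A)
    (hc : ∀ x, x ε P → (∃ y, y ε x) → ∃ y, y ε x ∧ PairMem c x y) (x : M) :
    ∃ y, IsChosen R A c x y ∧ (x ε A → y ε A ∧ R x y) := by
  by_cases hx : x ε A
  · obtain ⟨S, hS⟩ := exists_sep (fun u => R x u) A
    have hSA : Sub S A := fun u hu => ((hS u).1 hu).1
    obtain ⟨u, huA, hu⟩ := hA x hx
    obtain ⟨y, hyS, hy⟩ := hc S ((hP S).2 hSA) ⟨u, (hS u).2 ⟨huA, hu⟩⟩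
    exact ⟨y, Or.inl ⟨hx, S, hSA, fun u hu => ((hS u).1 hu).2,
      fun u huA hu => (hS u).2 ⟨huA, hu⟩, hy⟩, fun _ => (hS y).1 hyS⟩
  · exact ⟨x, Or.inr ⟨hx, rfl⟩, fun h => absurd h hx⟩

/-- Dependent choice for a definable relation, in a model with choice functions. -/
theorem exists_dependentChoice
    (hAC : ∀ a : M, ∃ c, IsFunctionOn c a ∧
      ∀ x, x ε a → (∃ y, y ε x) → ∃ y, y ε x ∧ PairMem c x y)
    (hR : ∀ x, ∃ y, R x y) (z : M) :
    ∃ w f : M, IsOmega w ∧ IsFunctionOn f w ∧ (∃ e, IsEmptySet e ∧ PairMem f e z) ∧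
      ∀ n, n ε w → ∃ s, IsSucc s n ∧ ∃ x y, PairMem f n x ∧ PairMem f s y ∧ R x y := by
  obtain ⟨w, hw⟩ := exists_isOmega M
  obtain ⟨A, hzA, hA⟩ := exists_closed hR z
  obtain ⟨P, hP⟩ := exists_powerset A
  obtain ⟨c, hcP, hc⟩ := hAC P
  have hch := exists_isChosen hA hP hc
  have huniq : ∀ x y y', IsChosen R A c x y → IsChosen R A c x y' → y = y' :=
    fun _ _ _ => IsChosen.unique hcP.1
  obtain ⟨f, hf, ⟨e, he, hfe⟩, hfs⟩ := hw.exists_recursion (IsChosen R A c)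
    (fun x => (hch x).imp fun _ => And.left) huniq z
  have hspec : ∀ x y, IsChosen R A c x y → x ε A → y ε A ∧ R x y := by
    intro x y hxy hx
    obtain ⟨y', hxy', h⟩ := hch x
    exact huniq x y y' hxy hxy' ▸ h hx
  obtain ⟨u, hu⟩ := exists_field f
  -- The sequence never leaves `A`, so the default value is never used. The bound by the field `u`
  -- keeps the induction `Δ₀^𝒫`.
  have hfA : ∀ n, n ε w → ∀ y, y ε u → PairMem f n y → y ε A := by
    refine hw.induction (fun n => ∀ y, y ε u → PairMem f n y → y ε A) ?_ ?_
    · intro e' he' _ y _ hy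
      obtain rfl := he.unique he'
      exact hf.1.2 e z y hfe hy ▸ hzA
    · intro m n hm hnm _ ih y _ hy
      obtain ⟨s, hs, x, y', hx, hy', hxy⟩ := hfs m hm
      obtain rfl := hs.unique hnm
      obtain rfl := hf.1.2 s y y' hy hy'
      exact (hspec x y hxy (ih x (hu m x hx).2 hx)).1
  refine ⟨w, f, hw, hf, ⟨e, he, hfe⟩, fun n hn => ?_⟩
  obtain ⟨s, hs, x, y, hx, hy, hxy⟩ := hfs n hn
  exact ⟨s, hs, x, y, hx, hy, (hspec x y hxy (hfA n hn x (hu n x hx).2 hx)).2⟩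

end DependentChoice

theorem models_dependentChoice {M : Type} [setLang.Structure M]
    (hM : ∀ τ ∈ kpPower ∪ {axiomOfChoice}, M ⊨ τ) {n : ℕ} {R : Predicate n 2}
    (hR : IsDelta0P R) : M ⊨ dependentChoice R := by
  have : KPModel M := ⟨fun τ hτ => hM τ (Or.inl hτ)⟩
  have hAC := hM axiomOfChoice (Or.inr rfl)
  simp [axiomOfChoice, Sentence.Realize, Formula.Realize, Fin.snoc] at hAC
  refine (models_univClosure _).2 fun p => ?_
  have : DefinableRel fun x y => R.Realize (Sum.elim p ![x, y]) :=
    ⟨(hR.definable p).congr fun v => by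
      rw [show v = ![v 0, v 1] from funext (Fin.forall_fin_two.2 ⟨rfl, rfl⟩)]; rfl⟩
  rw [Formula.Realize]
  simp [Fin.snoc]
  intro h z
  obtain ⟨w, f, hw, hf, hz, hfs⟩ := exists_dependentChoice (fun a => by simpa using hAC a) h z
  refine ⟨w, hw, f, hf, hz, fun n hn => ?_⟩
  obtain ⟨s, hs, x, y, hx, hy, hxy⟩ := hfs n hn
  exact ⟨s, hs, x, hx, y, hy, hxy⟩

end PowerKP

theorem mainTheorem10 (n : ℕ) (R : PowerKP.Predicate n 2) (hR : PowerKP.IsDelta0P R) :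
    (PowerKP.kpPower ∪ {PowerKP.axiomOfChoice}).Proves (PowerKP.dependentChoice R) :=
  PowerKP.proves_of_models _ _ fun _ _ _ hM => PowerKP.models_dependentChoice hM hR
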